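/- Let $D=\{z\in\mathbb C:|z|<1\}$, let $H(D)$ be the space of analytic functions on $D$, and let $\alpha,\beta>0$. Let $\mathcal Z^\alpha$ be the space of all $f\in H(D)$ with $\sup_{z\in D}(1-|z|^2)^\alpha|f''(z)|<\infty$, normed by $$\|f\|_{\mathcal Z^\alpha}=|f(0)|+|f'(0)|+\sup_{z\in D}(1-|z|^2)^\alpha|f''(z)|,$$ and put $\|u\|_{v_\beta}=\sup_{z\in D}(1-|z|^2)^\beta|u(z)|\in[0,\infty]$ for $u\in H(D)$. For an analytic map $\varphi:D\to D$ and $g\in H(D)$ let $$(U_gC_\varphi f)(z)=\int_0^z f(\varphi(\xi))\,g'(\xi)\,d\xi,\qquad z\in D.$$ For a bounded operator $T:\mathcal Z^\alpha\to\mathcal Z^\beta$ let $\|T\|_e=\inf\{\|T+K\|:K:\mathcal Z^\alpha\to\mathcal Z^\beta\text{ compact}\}$ be its essential norm. Write $a\asymp b$ if $C_1a\le b\le C_2a$, where $C_1,C_2>0$ are constants that depend only on $\alpha$ and $\beta$; $\varphi^n$ is the $n$-th power of $\varphi$. **Theorem.** Let $\varphi$ be an analytic self-map of $D$ and $g\in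 H(D)$, and suppose that $U_gC_\varphi:\mathcal Z^\alpha\to\mathcal Z^\beta$ is a bounded operator. (i) If $0<\alpha<1$, then $\|U_gC_\varphi\|_e=0$. (ii) If $\alpha=1$, then $\|U_gC_\varphi\|_e\asymp\limsup_{n\to\infty}(\log n)\,\|g'\varphi'\varphi^n\|_{v_\beta}$. (iii) If $1<\alpha<2$, then $\|U_gC_\varphi\|_e\asymp\limsup_{n\to\infty}(n+1)^{\alpha-1}\|g'\varphi'\varphi^n\|_{v_\beta}$. (iv) If $\alpha=2$, then $\|U_gC_\varphi\|_e\asymp\max\Big\{\limsup_{n\to\infty}(n+1)\|g'\varphi'\varphi^n\|_{v_\beta},\ \limsup_{n\to\infty}(\log n)\|g''\varphi^n\|_{v_\beta}\Big\}$. (v) If $\alpha>2$, then $\|U_gC_\varphi\|_e\asymp\max\Big\{\limsup_{n\to\infty}(n+1)^{\alpha-1}\|g'\varphi'\varphi^n\|_{v_\beta},\ \limsup_{n\to\infty}(n+1)^{\alpha-2}\|g''\varphi^n\|_{v_\beta}\Big\}$. -/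

import Mathlib

open Filter Metric
open scoped NNReal ENNReal

noncomputable section

namespace VolterraZygmund

/-- The open unit disc `D` of the complex plane. -/
abbrev disc : Set ℂ := ball (0 : ℂ) 1

/-- `f ∈ H(D)`: `f` is analytic (holomorphic) on the open unit disc. -/
def IsAnalyticOnDisc (f : ℂ → ℂ) : Prop := DifferentiableOn ℂ f disc

/-- `φ` is an analytic self-map of the open unit disc. -/
def IsAnalyticSelfMap (φ : ℂ → ℂ) : Prop :=
  IsAnalyticOnDisc φ ∧ Set.MapsTo φ disc disc

/-- The standard weight `v_α(z) = (1 - |z|²)^α`. -/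
def weight (α : ℝ) (z : ℂ) : ℝ := (1 - ‖z‖ ^ 2) ^ α

/-- The weighted sup-norm `‖u‖_{v_α} = sup_{z ∈ D} (1 - |z|²)^α |u(z)|`, with values in `[0, ∞]`. -/
def weightedNorm (α : ℝ) (u : ℂ → ℂ) : ℝ≥0∞ :=
  ⨆ z ∈ disc, ENNReal.ofReal (weight α z * ‖u z‖)

lemma weight_pos (α : ℝ) {z : ℂ} (hz : z ∈ disc) : 0 < weight α z := by
  have h : ‖z‖ < 1 := by simpa using hz
  have h0 := norm_nonneg z
  exact Real.rpow_pos_of_pos (by nlinarith) _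

lemma differentiableAt_of_disc {f : ℂ → ℂ} (hf : DifferentiableOn ℂ f disc) {z : ℂ}
    (hz : z ∈ disc) : DifferentiableAt ℂ f z :=
  hf.differentiableAt (isOpen_ball.mem_nhds hz)

lemma deriv_differentiableOn {f : ℂ → ℂ} (hf : DifferentiableOn ℂ f disc) :
    DifferentiableOn ℂ (deriv f) disc := hf.deriv isOpen_ball

lemma deriv_add_of_disc {f g : ℂ → ℂ} (hf : DifferentiableOn ℂ f disc)
    (hg : DifferentiableOn ℂ g disc) {z : ℂ} (hz : z ∈ disc) :
    deriv (f + g) z = deriv f z + deriv g z :=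
  deriv_add (differentiableAt_of_disc hf hz) (differentiableAt_of_disc hg hz)

lemma deriv2_add {f g : ℂ → ℂ} (hf : DifferentiableOn ℂ f disc)
    (hg : DifferentiableOn ℂ g disc) {z : ℂ} (hz : z ∈ disc) :
    deriv (deriv (f + g)) z = deriv (deriv f) z + deriv (deriv g) z := by
  have h : deriv (f + g) =ᶠ[nhds z] deriv f + deriv g := by
    filter_upwards [isOpen_ball.mem_nhds hz] with w hw
    exact deriv_add_of_disc hf hg hw
  rw [h.deriv_eq]
  exact deriv_add_of_disc (deriv_differentiableOn hf) (deriv_differentiableOn hg) hz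

lemma deriv2_smul (c : ℂ) (f : ℂ → ℂ) (z : ℂ) :
    deriv (deriv (c • f)) z = c * deriv (deriv f) z := by
  have h : deriv (c • f) = c • deriv f := by
    funext w
    simp [deriv_const_smul_field]
  rw [h]
  simp [deriv_const_smul_field]

/-- The Zygmund type space `Z^α` as a vector space: the functions `f` analytic on `D` such that
`sup_{z ∈ D} (1 - |z|²)^α |f''(z)| < ∞`. A function on `D` is represented by its extension
by `0` to the whole plane, so that two elements are equal exactly if they agree on `D`. -/
def zygmundSubmodule (α : ℝ) : Submodule ℂ (ℂ → ℂ) where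
  carrier := {f | IsAnalyticOnDisc f ∧ (∀ z, z ∉ disc → f z = 0) ∧
    ∃ M : ℝ, ∀ z ∈ disc, weight α z * ‖deriv (deriv f) z‖ ≤ M}
  zero_mem' := ⟨differentiableOn_const _, fun _ _ => rfl, 0, fun z _ => by
    have h : deriv (0 : ℂ → ℂ) = 0 := by
      funext w
      exact deriv_const w (0 : ℂ)
    simp [h]⟩
  add_mem' := by
    rintro f g ⟨hf, hf0, M, hM⟩ ⟨hg, hg0, N, hN⟩
    refine ⟨hf.add hg, fun z hz => by simp [hf0 z hz, hg0 z hz], M + N, fun z hz => ?_⟩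
    rw [deriv2_add hf hg hz]
    have h1 := mul_le_mul_of_nonneg_left
      (norm_add_le (deriv (deriv f) z) (deriv (deriv g) z)) (weight_pos α hz).le
    have h2 := hM z hz
    have h3 := hN z hz
    linarith
  smul_mem' := by
    rintro c f ⟨hf, hf0, M, hM⟩
    refine ⟨hf.const_smul c, fun z hz => by simp [hf0 z hz], ‖c‖ * M, fun z hz => ?_⟩
    rw [deriv2_smul, norm_mul]
    have h1 := mul_le_mul_of_nonneg_left (hM z hz) (norm_nonneg c)
    linarith

/-- The Zygmund type space `Z^α`. Its topology is the one of the norm below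
(and not the topology of pointwise convergence). -/
def Zygmund (α : ℝ) : Type := zygmundSubmodule α

instance (α : ℝ) : AddCommGroup (Zygmund α) := inferInstanceAs (AddCommGroup (zygmundSubmodule α))

instance (α : ℝ) : Module ℂ (Zygmund α) := inferInstanceAs (Module ℂ (zygmundSubmodule α))

/-- The underlying function of an element of `Z^α`. -/
def Zygmund.toFun {α : ℝ} (f : Zygmund α) : ℂ → ℂ := Subtype.val (p := (· ∈ zygmundSubmodule α)) f

instance (α : ℝ) : CoeFun (Zygmund α) (fun _ => ℂ → ℂ) := ⟨Zygmund.toFun⟩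

lemma Zygmund.mem {α : ℝ} (f : Zygmund α) : f.toFun ∈ zygmundSubmodule α :=
  Subtype.property (p := (· ∈ zygmundSubmodule α)) f

/-- The norm `‖f‖_{Z^α} = |f(0)| + |f'(0)| + sup_{z ∈ D} (1 - |z|²)^α |f''(z)|`. -/
instance (α : ℝ) : Norm (Zygmund α) :=
  ⟨fun f => ‖f 0‖ + ‖deriv f 0‖ + ⨆ z : disc, weight α z * ‖deriv (deriv f) z‖⟩

lemma Zygmund.norm_def {α : ℝ} (f : Zygmund α) :
    ‖f‖ = ‖f 0‖ + ‖deriv f 0‖ + ⨆ z : disc, weight α z * ‖deriv (deriv f) z‖ := rfl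

lemma Zygmund.bddAbove {α : ℝ} (f : Zygmund α) :
    BddAbove (Set.range fun z : disc => weight α z * ‖deriv (deriv f) z‖) := by
  obtain ⟨M, hM⟩ := f.mem.2.2
  exact ⟨M, by rintro _ ⟨z, rfl⟩; exact hM z z.2⟩

lemma zero_mem_disc : (0 : ℂ) ∈ disc := mem_ball_self one_pos

instance : Nonempty disc := ⟨⟨0, zero_mem_disc⟩⟩

lemma eqOn_of_deriv_zero {f : ℂ → ℂ} (hf : DifferentiableOn ℂ f disc)
    (h : ∀ z ∈ disc, deriv f z = 0) (h0 : f 0 = 0) : ∀ z ∈ disc, f z = 0 := by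
  intro z hz
  have := isOpen_ball.is_const_of_deriv_eq_zero (convex_ball (0 : ℂ) 1).isPreconnected hf
    (fun w hw => h w hw) hz zero_mem_disc
  rw [this, h0]

lemma Zygmund.sup_nonneg {α : ℝ} (f : Zygmund α) :
    0 ≤ ⨆ z : disc, weight α z * ‖deriv (deriv f) z‖ :=
  Real.iSup_nonneg fun z => mul_nonneg (weight_pos α z.2).le (norm_nonneg _)

lemma Zygmund.core (α : ℝ) : NormedSpace.Core ℂ (Zygmund α) where
  norm_nonneg f := by
    rw [Zygmund.norm_def]
    have := f.sup_nonneg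
    positivity
  norm_smul c f := by
    have h1 : (c • f : Zygmund α) 0 = c * f 0 := rfl
    have h2 : deriv (c • f : Zygmund α) 0 = c * deriv f 0 := by
      change deriv (c • f.toFun) 0 = _
      simp [deriv_const_smul_field]
    have h3 : ∀ z, deriv (deriv (c • f : Zygmund α)) z = c * deriv (deriv f) z :=
      fun z => deriv2_smul c f z
    rw [Zygmund.norm_def, Zygmund.norm_def, h1, h2, mul_add, mul_add,
      Real.mul_iSup_of_nonneg (norm_nonneg c), norm_mul, norm_mul]
    congr 2
    funext z
    rw [h3, norm_mul]
    ring
  norm_triangle f g := by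
    have h2 : deriv (f + g : Zygmund α) 0 = deriv f 0 + deriv g 0 :=
      deriv_add_of_disc f.mem.1 g.mem.1 zero_mem_disc
    have h3 : ∀ z ∈ disc, deriv (deriv (f + g : Zygmund α)) z
        = deriv (deriv f) z + deriv (deriv g) z :=
      fun z hz => deriv2_add f.mem.1 g.mem.1 hz
    have h1 : (f + g : Zygmund α) 0 = f 0 + g 0 := rfl
    rw [Zygmund.norm_def, Zygmund.norm_def, Zygmund.norm_def, h1, h2]
    have h4 := norm_add_le (f 0) (g 0)
    have h5 := norm_add_le (deriv f 0) (deriv g 0)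
    have h6 : (⨆ z : disc, weight α z * ‖deriv (deriv (f + g : Zygmund α)) z‖)
        ≤ (⨆ z : disc, weight α z * ‖deriv (deriv f) z‖)
          + ⨆ z : disc, weight α z * ‖deriv (deriv g) z‖ := by
      refine ciSup_le fun z => ?_
      rw [h3 z z.2]
      have e1 := le_ciSup f.bddAbove z
      have e2 := le_ciSup g.bddAbove z
      have e3 := mul_le_mul_of_nonneg_left
        (norm_add_le (deriv (deriv f) z) (deriv (deriv g) z)) (weight_pos α z.2).le
      linarith
    linarith
  norm_eq_zero_iff f := by
    constructor
    · intro h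
      rw [Zygmund.norm_def] at h
      have hs := f.sup_nonneg
      have n0 := norm_nonneg (f 0)
      have n1 := norm_nonneg (deriv f 0)
      have h0 : f 0 = 0 := norm_eq_zero.1 (by linarith)
      have h1 : deriv f 0 = 0 := norm_eq_zero.1 (by linarith)
      have h2 : ∀ z ∈ disc, deriv (deriv f) z = 0 := by
        intro z hz
        have e := le_ciSup f.bddAbove ⟨z, hz⟩
        dsimp only at e
        have e' : weight α z * ‖deriv (deriv f) z‖ ≤ 0 := by linarith
        have p := weight_pos α hz
        have q := norm_nonneg (deriv (deriv f) z)
        exact norm_eq_zero.1 (by nlinarith)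
      have h3 := eqOn_of_deriv_zero (deriv_differentiableOn f.mem.1) h2 h1
      have h4 := eqOn_of_deriv_zero f.mem.1 h3 h0
      refine Subtype.ext (funext fun z => ?_)
      by_cases hz : z ∈ disc
      · exact h4 z hz
      · exact f.mem.2.1 z hz
    · rintro rfl
      have h : deriv ((0 : Zygmund α) : ℂ → ℂ) = 0 := by
        funext w
        exact deriv_const w (0 : ℂ)
      have h' : deriv (0 : ℂ → ℂ) = 0 := by
        funext w
        exact deriv_const w (0 : ℂ)
      have h0 : (0 : Zygmund α) 0 = 0 := rfl
      rw [Zygmund.norm_def, h, h', h0]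
      simp

instance (α : ℝ) : NormedAddCommGroup (Zygmund α) :=
  NormedAddCommGroup.ofCore (Zygmund.core α)

instance (α : ℝ) : NormedSpace ℂ (Zygmund α) := NormedSpace.ofCore (Zygmund.core α)

/-- `(U_g C_φ f)(z) = ∫_0^z f(φ(ξ)) g'(ξ) dξ`, the integral being taken along the segment
`ξ = t z`, `0 ≤ t ≤ 1`. -/
def volterraComp (g φ f : ℂ → ℂ) (z : ℂ) : ℂ :=
  ∫ t in (0 : ℝ)..1, f (φ (t * z)) * deriv g (t * z) * z

/-- The bounded operator `T : Z^α → Z^β` is `U_g C_φ`. Thus `U_g C_φ : Z^α → Z^β` is bounded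
if and only if there is such a `T` (which is then unique). -/
def IsVolterraComp {α β : ℝ} (g φ : ℂ → ℂ) (T : Zygmund α →L[ℂ] Zygmund β) : Prop :=
  ∀ f : Zygmund α, ∀ z ∈ disc, T f z = volterraComp g φ f z

/-- The essential norm `inf {‖T + K‖ : K : X → Y compact}`. -/
def essNorm {X Y : Type*} [NormedAddCommGroup X] [NormedSpace ℂ X]
    [NormedAddCommGroup Y] [NormedSpace ℂ Y] (T : X →L[ℂ] Y) : ℝ≥0∞ :=
  ⨅ (K : X →L[ℂ] Y) (_ : IsCompactOperator K), ‖T + K‖ₑ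

/-- `C₁ a ≤ b ≤ C₂ a`. -/
def Comparable (C₁ C₂ : ℝ≥0) (a b : ℝ≥0∞) : Prop := C₁ * a ≤ b ∧ b ≤ C₂ * a

/-- `limsup_{n → ∞} (log n) ‖u φ^n‖_{v_β}`. -/
def logLimsup (β : ℝ) (u φ : ℂ → ℂ) : ℝ≥0∞ :=
  limsup (fun n : ℕ => ENNReal.ofReal (Real.log n) * weightedNorm β (fun z => u z * φ z ^ n)) atTop

/-- `limsup_{n → ∞} (n + 1)^s ‖u φ^n‖_{v_β}`. -/
def powLimsup (s β : ℝ) (u φ : ℂ → ℂ) : ℝ≥0∞ :=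
  limsup (fun n : ℕ => ENNReal.ofReal (((n : ℝ) + 1) ^ s) *
    weightedNorm β (fun z => u z * φ z ^ n)) atTop

end VolterraZygmund

end

open VolterraZygmund
open scoped NNReal ENNReal

open Filter Metric
open scoped NNReal ENNReal

noncomputable section

namespace VolterraZygmund

/-! Put u = g'φ'. Everything rests on (Tf)'' = u·f'(φ) + g''·f(φ) (`IsVolterraComp.deriv_deriv`). Up
to data at the origin, the essential norm measures how large the two terms can be where |φ| is close
to 1. For f in the unit ball of Z^α, f' grows at most like a primitive of (1-|z|)^(-α) and f like a
second primitive. These are bounded, logarithmic or powers according to the position of α relative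
to 1 and 2, whence the five regimes. The choice n ≈ 1/(1-|φ|) keeps |φ|^n bounded below and turns
growth in 1/(1-|φ|) into growth in n (`exists_bound_of_limsup_lt`).

Upper bound: replacing f'' by a Taylor polynomial of f''(rz) gives a finite rank operator L such
that f - Lf has norm at most 3‖f‖ and small second derivative on a given disc |z| ≤ ρ
(`exists_compact_approx`). Integrating the bound for (f - Lf)'' outwards from |z| = ρ controls its
first two primitives (`GrowthControl`), and the formula for (Tf)'' then bounds ‖T - TL‖
(`IsVolterraComp.essNorm_le`).

Lower bound: polynomials with nonnegative coefficients, bounded in norm and tending to zero locally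
uniformly, are weakly null. The dual space is not needed for this: by a gliding hump, sums of N
sparsely chosen members have norm at most M + Nε (`exists_finset_sum_le`), so compact operators send
the sequence to zero (`IsNullSeq.tendsto_compact`). Monomials produce the power limsups, and blocks
of exponents m ≤ i < m² the logarithmic ones. The u-term and the g''-term might cancel. For α < 2
the g''-term of the test functions tends to zero; for α ≥ 2 a combination of two monomials
eliminates g'' and bounds the u-term, after which the g''-term follows by the triangle inequality.
-/

lemma mem_disc {z : ℂ} : z ∈ disc ↔ ‖z‖ < 1 := by simp

lemma Zygmund.hasDerivAt {α : ℝ} (f : Zygmund α) {z : ℂ} (hz : z ∈ disc) :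
    HasDerivAt f (deriv f z) z := (differentiableAt_of_disc f.mem.1 hz).hasDerivAt

lemma Zygmund.hasDerivAt_deriv {α : ℝ} (f : Zygmund α) {z : ℂ} (hz : z ∈ disc) :
    HasDerivAt (deriv f) (deriv (deriv f) z) z :=
  (differentiableAt_of_disc (deriv_differentiableOn f.mem.1) hz).hasDerivAt

lemma Zygmund.norm_le {α : ℝ} (f : Zygmund α) {M : ℝ}
    (h : ∀ z ∈ disc, weight α z * ‖deriv (deriv f) z‖ ≤ M) :
    ‖f‖ ≤ ‖f 0‖ + ‖deriv f 0‖ + M := by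
  rw [Zygmund.norm_def]
  gcongr
  exact ciSup_le fun z => h z z.2

lemma Zygmund.weight_mul_le {α : ℝ} (f : Zygmund α) {z : ℂ} (hz : z ∈ disc) :
    weight α z * ‖deriv (deriv f) z‖ ≤ ‖f‖ := by
  rw [Zygmund.norm_def]
  have h := le_ciSup f.bddAbove ⟨z, hz⟩
  dsimp only at h
  have := norm_nonneg (f 0)
  have := norm_nonneg (deriv f 0)
  linarith

lemma Zygmund.norm_apply_zero_le {α : ℝ} (f : Zygmund α) : ‖f 0‖ ≤ ‖f‖ := by
  rw [Zygmund.norm_def]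
  have := f.sup_nonneg
  have := norm_nonneg (deriv f 0)
  linarith

lemma Zygmund.norm_deriv_zero_le {α : ℝ} (f : Zygmund α) : ‖deriv f 0‖ ≤ ‖f‖ := by
  rw [Zygmund.norm_def]
  have := f.sup_nonneg
  have := norm_nonneg (f 0)
  linarith

lemma deriv2_eq_of_hasDerivAt {f f₁ : ℂ → ℂ} {a z : ℂ} (hz : z ∈ disc)
    (h₁ : ∀ w ∈ disc, HasDerivAt f (f₁ w) w) (h₂ : HasDerivAt f₁ a z) :
    deriv (deriv f) z = a := by
  have h : deriv f =ᶠ[nhds z] f₁ := by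
    filter_upwards [isOpen_ball.mem_nhds hz] with w hw using (h₁ w hw).deriv
  rw [h.deriv_eq, h₂.deriv]

/-- A function on the disc whose second derivative has growth of order `α` defines an element
of `Z^α`. -/
lemma Zygmund.exists_eqOn {α : ℝ} {f f₁ f₂ : ℂ → ℂ} (h₁ : ∀ z ∈ disc, HasDerivAt f (f₁ z) z)
    (h₂ : ∀ z ∈ disc, HasDerivAt f₁ (f₂ z) z) {M : ℝ}
    (hM : ∀ z ∈ disc, weight α z * ‖f₂ z‖ ≤ M) :
    ∃ F : Zygmund α, ∀ z ∈ disc, F z = f z ∧ deriv F z = f₁ z ∧ deriv (deriv F) z = f₂ z := by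
  have e : ∀ z ∈ disc, disc.indicator f =ᶠ[nhds z] f := fun z hz => by
    filter_upwards [isOpen_ball.mem_nhds hz] with w hw using Set.indicator_of_mem hw f
  have d₁ : ∀ z ∈ disc, HasDerivAt (disc.indicator f) (f₁ z) z :=
    fun z hz => (h₁ z hz).congr_of_eventuallyEq (e z hz)
  have d₂ : ∀ z ∈ disc, deriv (deriv (disc.indicator f)) z = f₂ z :=
    fun z hz => deriv2_eq_of_hasDerivAt hz d₁ (h₂ z hz)
  refine ⟨⟨disc.indicator f, fun z hz => (d₁ z hz).differentiableAt.differentiableWithinAt,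
    fun z hz => Set.indicator_of_notMem hz f, M, fun z hz => by rw [d₂ z hz]; exact hM z hz⟩,
    fun z hz => ⟨Set.indicator_of_mem hz f, (d₁ z hz).deriv, d₂ z hz⟩⟩

/-! ### The second derivative of the image and its coefficients -/

section Volterra

variable {α β : ℝ} {g φ : ℂ → ℂ} {T : Zygmund α →L[ℂ] Zygmund β}

/-- The integrand has a primitive F on the disc, so the integral along the segment is F(z) - F(0).
-/
lemma hasDerivAt_volterraComp (hφ : IsAnalyticSelfMap φ) (hg : IsAnalyticOnDisc g) {f : ℂ → ℂ}
    (hf : IsAnalyticOnDisc f) {z : ℂ} (hz : z ∈ disc) :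
    HasDerivAt (volterraComp g φ f) (f (φ z) * deriv g z) z := by
  have hd : DifferentiableOn ℂ (fun z => f (φ z) * deriv g z) disc :=
    (hf.comp hφ.1 hφ.2).mul (deriv_differentiableOn hg)
  obtain ⟨F, hF⟩ := hd.isExactOn_ball
  have key : ∀ w ∈ disc, volterraComp g φ f w = F w - F 0 := by
    intro w hw
    have hseg : ∀ t ∈ Set.uIcc (0 : ℝ) 1, (t : ℂ) * w ∈ disc := by
      intro t ht
      rw [Set.uIcc_of_le zero_le_one] at ht
      rw [mem_disc] at hw ⊢
      rw [norm_mul, Complex.norm_real, Real.norm_of_nonneg ht.1]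
      nlinarith [norm_nonneg w, ht.1, ht.2]
    have h1 : ∀ t ∈ Set.uIcc (0 : ℝ) 1, HasDerivAt (fun t : ℝ => F (t * w))
        (f (φ (t * w)) * deriv g (t * w) * w) t := by
      intro t ht
      have h2 : HasDerivAt (fun t : ℝ => (t : ℂ) * w) w t := by
        simpa using (Complex.ofRealCLM.hasDerivAt (x := t)).mul_const w
      exact (hF _ (hseg t ht)).comp t h2
    have hc : ContinuousOn (fun t : ℝ => f (φ (t * w)) * deriv g (t * w) * w)
        (Set.uIcc (0 : ℝ) 1) := by
      refine ContinuousOn.mul ?_ continuousOn_const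
      exact hd.continuousOn.comp (by fun_prop) hseg
    have := intervalIntegral.integral_eq_sub_of_hasDerivAt h1 hc.intervalIntegrable
    simpa [volterraComp] using this
  have e : volterraComp g φ f =ᶠ[nhds z] fun w => F w - F 0 := by
    filter_upwards [isOpen_ball.mem_nhds hz] with w hw using key w hw
  exact ((hF z hz).sub_const _).congr_of_eventuallyEq e

lemma IsVolterraComp.hasDerivAt (hT : IsVolterraComp g φ T) (hφ : IsAnalyticSelfMap φ)
    (hg : IsAnalyticOnDisc g) (f : Zygmund α) {z : ℂ} (hz : z ∈ disc) :
    HasDerivAt (T f) (f (φ z) * deriv g z) z := by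
  refine (hasDerivAt_volterraComp hφ hg f.mem.1 hz).congr_of_eventuallyEq ?_
  filter_upwards [isOpen_ball.mem_nhds hz] with w hw using hT f w hw

lemma IsVolterraComp.apply_zero (hT : IsVolterraComp g φ T) (f : Zygmund α) : T f 0 = 0 := by
  rw [hT f 0 zero_mem_disc]
  simp [volterraComp]

lemma IsVolterraComp.deriv_deriv (hT : IsVolterraComp g φ T) (hφ : IsAnalyticSelfMap φ)
    (hg : IsAnalyticOnDisc g) (f : Zygmund α) {z : ℂ} (hz : z ∈ disc) :
    deriv (deriv (T f)) z =
      deriv g z * deriv φ z * deriv f (φ z) + deriv (deriv g) z * f (φ z) := by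
  refine deriv2_eq_of_hasDerivAt hz (fun w hw => hT.hasDerivAt hφ hg f hw) ?_
  have h1 : HasDerivAt (fun z => f (φ z)) (deriv f (φ z) * deriv φ z) z :=
    (f.hasDerivAt (hφ.2 hz)).comp z (differentiableAt_of_disc hφ.1 hz).hasDerivAt
  have h2 := h1.mul (differentiableAt_of_disc (deriv_differentiableOn hg) hz).hasDerivAt
  exact h2.congr_deriv (by ring)

lemma IsVolterraComp.weight_mul_le (hT : IsVolterraComp g φ T) (hφ : IsAnalyticSelfMap φ)
    (hg : IsAnalyticOnDisc g) (f : Zygmund α) {z : ℂ} (hz : z ∈ disc) :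
    weight β z * ‖deriv g z * deriv φ z * deriv f (φ z) + deriv (deriv g) z * f (φ z)‖
      ≤ ‖T f‖ := by
  rw [← hT.deriv_deriv hφ hg f hz]
  exact (T f).weight_mul_le hz

/-- Testing on the constant 1 isolates g''; testing on the identity gives g'φ' + g''φ, from which
the second summand is removed using |φ| < 1. -/
lemma IsVolterraComp.exists_bound (hT : IsVolterraComp g φ T) (hφ : IsAnalyticSelfMap φ)
    (hg : IsAnalyticOnDisc g) : ∃ M : ℝ, 0 < M ∧ ∀ z ∈ disc,
      weight β z * ‖deriv g z * deriv φ z‖ ≤ M ∧ weight β z * ‖deriv (deriv g) z‖ ≤ M := by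
  obtain ⟨F, hF⟩ := Zygmund.exists_eqOn (α := α) (f := fun _ => 1) (f₁ := fun _ => 0)
    (f₂ := fun _ => 0) (M := 0) (fun z _ => hasDerivAt_const z _) (fun z _ => hasDerivAt_const z _)
    (fun z _ => by simp)
  obtain ⟨G, hG⟩ := Zygmund.exists_eqOn (α := α) (f := fun z => z) (f₁ := fun _ => 1)
    (f₂ := fun _ => 0) (M := 0) (fun z _ => hasDerivAt_id' z) (fun z _ => hasDerivAt_const z _)
    (fun z _ => by simp)
  have hw : ∀ z ∈ disc, weight β z * ‖deriv (deriv g) z‖ ≤ ‖T F‖ := by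
    intro z hz
    have := hT.weight_mul_le hφ hg F hz
    rwa [(hF _ (hφ.2 hz)).1, (hF _ (hφ.2 hz)).2.1, mul_zero, zero_add, mul_one] at this
  refine ⟨‖T F‖ + ‖T G‖ + 1, by positivity, fun z hz => ⟨?_, ?_⟩⟩
  · have h1 := hT.weight_mul_le hφ hg G hz
    rw [(hG _ (hφ.2 hz)).1, (hG _ (hφ.2 hz)).2.1, mul_one] at h1
    have h2 := hw z hz
    have h3 : ‖φ z‖ < 1 := mem_disc.1 (hφ.2 hz)
    have h4 : ‖deriv g z * deriv φ z‖ ≤ ‖deriv g z * deriv φ z + deriv (deriv g) z * φ z‖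
        + ‖deriv (deriv g) z‖ := by
      have h5 : ‖deriv (deriv g) z * φ z‖ ≤ ‖deriv (deriv g) z‖ := by
        rw [norm_mul]
        nlinarith [norm_nonneg (deriv (deriv g) z), norm_nonneg (φ z)]
      have h6 := norm_sub_le (deriv g z * deriv φ z + deriv (deriv g) z * φ z)
        (deriv (deriv g) z * φ z)
      rw [add_sub_cancel_right] at h6
      linarith
    have h7 := mul_le_mul_of_nonneg_left h4 (weight_pos β hz).le
    linarith
  · have := hw z hz
    have := norm_nonneg (T G)
    linarith

end Volterra

/-! ### Weakly null sequences and compact operators -/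

/-- Gliding hump: a bounded sequence of nonnegative functions on the disc, each vanishing at the
boundary and tending to zero locally uniformly, has almost disjointly supported members. -/
lemma exists_finset_sum_le {G : ℕ → ℂ → ℝ} {M : ℝ} (hM0 : 0 ≤ M)
    (hM : ∀ n, ∀ z ∈ disc, G n z ≤ M)
    (hb : ∀ n, ∀ ε > 0, ∃ ρ < 1, ∀ z ∈ disc, ρ < ‖z‖ → G n z ≤ ε)
    (hl : ∀ ρ < 1, ∀ ε > 0, ∀ᶠ n in atTop, ∀ z ∈ disc, ‖z‖ ≤ ρ → G n z ≤ ε)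
    (n₀ : ℕ) {ε : ℝ} (hε : 0 < ε) (N : ℕ) :
    ∃ S : Finset ℕ, S.card = N ∧ (∀ i ∈ S, n₀ ≤ i) ∧
      ∀ z ∈ disc, ∑ i ∈ S, G i z ≤ M + N * ε := by
  induction N with
  | zero => exact ⟨∅, by simp, by simp, by simpa using fun _ _ => hM0⟩
  | succ N ih =>
    obtain ⟨S, hS, hS0, hSG⟩ := ih
    -- The finitely many members already chosen have sum at most ε beyond some radius ρ. The next
    -- member is taken small on |z| ≤ ρ, so at every point either it or the old sum contributes at
    -- most ε.
    obtain ⟨ρ, hρ, hSρ⟩ : ∃ ρ < (1 : ℝ), ∀ z ∈ disc, ρ < ‖z‖ → ∑ i ∈ S, G i z ≤ ε := by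
      choose ρ hρ h using fun n => hb n (ε / (N + 1)) (by positivity)
      obtain ⟨R, hR, hR'⟩ : ∃ R < (1 : ℝ), ∀ i ∈ S, ρ i ≤ R := by
        clear hS hS0 hSG
        induction S using Finset.induction_on with
        | empty => exact ⟨0, one_pos, by simp⟩
        | insert a s _ ih =>
          obtain ⟨R, hR, h⟩ := ih
          refine ⟨max (ρ a) R, max_lt (hρ a) hR, fun i hi => ?_⟩
          rcases Finset.mem_insert.1 hi with rfl | hi
          · exact le_max_left _ _
          · exact (h i hi).trans (le_max_right _ _)
      refine ⟨R, hR, fun z hz hzR => ?_⟩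
      calc ∑ i ∈ S, G i z ≤ ∑ i ∈ S, ε / (N + 1) :=
            Finset.sum_le_sum fun i hi => h i z hz ((hR' i hi).trans_lt hzR)
        _ = N / (N + 1) * ε := by rw [Finset.sum_const, hS, nsmul_eq_mul]; ring
        _ ≤ 1 * ε := by
            gcongr
            rw [div_le_one (by positivity)]
            linarith
        _ = ε := one_mul ε
    obtain ⟨m, hm, hmn, hmS⟩ := ((hl ρ hρ ε hε).and ((eventually_ge_atTop n₀).and
      (S.finite_toSet.eventually_cofinite_notMem.filter_mono Nat.cofinite_eq_atTop.ge))).exists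
    refine ⟨insert m S, by rw [Finset.card_insert_of_notMem (by simpa using hmS), hS],
      fun i hi => ?_, fun z hz => ?_⟩
    · rcases Finset.mem_insert.1 hi with rfl | hi
      exacts [hmn, hS0 i hi]
    · rw [Finset.sum_insert (by simpa using hmS)]
      push_cast
      have hN : 0 ≤ (N : ℝ) * ε := by positivity
      rcases le_or_gt ‖z‖ ρ with h | h
      · linarith [hm z hz h, hSG z hz]
      · linarith [hSρ z hz h, hM m z hz]

/-- The conditions that make a sequence in `Z^α` weakly null. -/
structure IsNullSeq {α : ℝ} (F : ℕ → Zygmund α) (M : ℝ) : Prop where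
  apply_zero : ∀ n, F n 0 = 0
  deriv_zero : ∀ n, deriv (F n) 0 = 0
  bound : ∀ n, ∀ z ∈ disc, weight α z * ‖deriv (deriv (F n)) z‖ ≤ M
  boundary : ∀ n, ∀ ε > 0, ∃ ρ < 1, ∀ z ∈ disc, ρ < ‖z‖ →
    weight α z * ‖deriv (deriv (F n)) z‖ ≤ ε
  locally : ∀ ρ < 1, ∀ ε > 0, ∀ᶠ n in atTop, ∀ z ∈ disc, ‖z‖ ≤ ρ →
    weight α z * ‖deriv (deriv (F n)) z‖ ≤ ε

section Null

variable {α : ℝ} {F : ℕ → Zygmund α} {M : ℝ}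

lemma IsNullSeq.nonneg (h : IsNullSeq F M) : 0 ≤ M :=
  (mul_nonneg (weight_pos α zero_mem_disc).le (norm_nonneg _)).trans (h.bound 0 0 zero_mem_disc)

lemma IsNullSeq.norm_le (h : IsNullSeq F M) (n : ℕ) : ‖F n‖ ≤ M := by
  have := (F n).norm_le (h.bound n)
  simpa [h.apply_zero, h.deriv_zero] using this

lemma IsNullSeq.comp (h : IsNullSeq F M) {ψ : ℕ → ℕ} (hψ : Tendsto ψ atTop atTop) :
    IsNullSeq (F ∘ ψ) M where
  apply_zero _ := h.apply_zero _
  deriv_zero _ := h.deriv_zero _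
  bound _ := h.bound _
  boundary _ := h.boundary _
  locally ρ hρ ε hε := hψ.eventually (h.locally ρ hρ ε hε)

lemma Zygmund.sum_props (S : Finset ℕ) (F : ℕ → Zygmund α) {z : ℂ} (hz : z ∈ disc) :
    (∑ i ∈ S, F i) z = ∑ i ∈ S, F i z ∧ deriv (∑ i ∈ S, F i : Zygmund α) z =
      ∑ i ∈ S, deriv (F i) z ∧ deriv (deriv (∑ i ∈ S, F i : Zygmund α)) z =
      ∑ i ∈ S, deriv (deriv (F i)) z := by
  induction S using Finset.induction_on with
  | empty =>
    have h : deriv ((0 : Zygmund α) : ℂ → ℂ) = 0 := funext fun w => deriv_const w (0 : ℂ)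
    have h' : deriv (0 : ℂ → ℂ) = 0 := funext fun w => deriv_const w (0 : ℂ)
    refine ⟨rfl, ?_, ?_⟩ <;> simp [h, h']
  | insert a s ha ih =>
    simp only [Finset.sum_insert ha, ← ih.1, ← ih.2.1, ← ih.2.2]
    exact ⟨rfl, deriv_add_of_disc (F a).mem.1 (∑ i ∈ s, F i).mem.1 hz,
      deriv2_add (F a).mem.1 (∑ i ∈ s, F i).mem.1 hz⟩

variable {Y : Type*} [NormedAddCommGroup Y] [NormedSpace ℂ Y]

/-- A sum of N sparse members has norm at most M + Nε, while its image lies within Nε of N·y. Hence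
N‖y‖ ≤ ‖K‖(M + Nε) + Nε for all N, which is impossible for small ε and large N unless y = 0. -/
lemma IsNullSeq.eq_zero_of_tendsto (h : IsNullSeq F M) (K : Zygmund α →L[ℂ] Y) {y : Y}
    (hy : Tendsto (fun n => K (F n)) atTop (nhds y)) : y = 0 := by
  have key : ∀ ε > 0, ∀ N : ℕ, (N : ℝ) * ‖y‖ ≤ ‖K‖ * (M + N * ε) + N * ε := by
    intro ε hε N
    obtain ⟨n₀, hn₀⟩ := Metric.tendsto_atTop.1 hy ε hε
    obtain ⟨S, hS, hS0, hSG⟩ := exists_finset_sum_le h.nonneg h.bound h.boundary h.locally n₀ hε N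
    have h1 : ‖∑ i ∈ S, F i‖ ≤ M + N * ε := by
      have e := Zygmund.sum_props S F zero_mem_disc
      have := (∑ i ∈ S, F i).norm_le (M := M + N * ε) (fun z hz => by
        rw [(Zygmund.sum_props S F hz).2.2]
        refine le_trans ?_ (hSG z hz)
        rw [← Finset.mul_sum]
        exact mul_le_mul_of_nonneg_left (norm_sum_le _ _) (weight_pos α hz).le)
      simpa [e.1, e.2.1, h.apply_zero, h.deriv_zero] using this
    have h2 : ‖K (∑ i ∈ S, F i)‖ ≤ ‖K‖ * (M + N * ε) := K.le_opNorm_of_le h1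
    have h3 : ‖(N : ℂ) • y - K (∑ i ∈ S, F i)‖ ≤ N * ε := by
      have e : (N : ℂ) • y - K (∑ i ∈ S, F i) = ∑ i ∈ S, (y - K (F i)) := by
        rw [map_sum, Finset.sum_sub_distrib, Finset.sum_const, hS, Nat.cast_smul_eq_nsmul]
      rw [e]
      refine (norm_sum_le_of_le S (f := fun i => y - K (F i)) (n := fun _ => ε)
        fun i hi => ?_).trans ?_
      · rw [← dist_eq_norm, dist_comm]
        exact (hn₀ i (hS0 i hi)).le
      · simp [hS]
    have h4 : ‖(N : ℂ) • y‖ = N * ‖y‖ := by simp [norm_smul]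
    have h5 := norm_sub_norm_le ((N : ℂ) • y) (K (∑ i ∈ S, F i))
    linarith
  by_contra hne
  have hpos : 0 < ‖y‖ := norm_pos_iff.2 hne
  have hK := norm_nonneg K
  obtain ⟨N, hN⟩ := exists_nat_gt (2 * ‖K‖ * M / ‖y‖)
  -- With this ε the error terms (‖K‖ + 1)Nε are exactly N‖y‖/2, half of the left-hand side.
  have h1 := key (‖y‖ / (2 * (‖K‖ + 1))) (by positivity) N
  have h2 : ‖K‖ * (M + N * (‖y‖ / (2 * (‖K‖ + 1)))) + N * (‖y‖ / (2 * (‖K‖ + 1)))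
      = ‖K‖ * M + N * ‖y‖ / 2 := by
    field_simp
    ring
  rw [div_lt_iff₀ hpos] at hN
  linarith

lemma IsNullSeq.tendsto_compact (h : IsNullSeq F M) {K : Zygmund α →L[ℂ] Y}
    (hK : IsCompactOperator K) : Tendsto (fun n => K (F n)) atTop (nhds 0) := by
  refine tendsto_of_subseq_tendsto fun ns hns => ?_
  have hc := hK.isCompact_closure_image_closedBall (f := (K : Zygmund α →ₗ[ℂ] Y)) M
  obtain ⟨y, _, ψ, hψ, hy⟩ := hc.tendsto_subseq (x := fun n => K (F (ns n)))
    (fun n => subset_closure ⟨F (ns n), by simpa using h.norm_le _, rfl⟩)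
  refine ⟨ψ, ?_⟩
  rwa [(h.comp (hns.comp hψ.tendsto_atTop)).eq_zero_of_tendsto K hy] at hy

/-- For a compact K with ‖T + K‖ < c, the part (T + K)F_n has norm at most M‖T + K‖, and K F_n tends
to zero, so it eventually fits into the gap M(c - ‖T + K‖). -/
lemma IsNullSeq.eventually_norm_le (h : IsNullSeq F M) (hM : 0 < M) {T : Zygmund α →L[ℂ] Y}
    {c : ℝ} (hc : essNorm T < ENNReal.ofReal c) : ∀ᶠ n in atTop, ‖T (F n)‖ ≤ M * c := by
  obtain ⟨K, hK⟩ := iInf_lt_iff.1 hc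
  obtain ⟨hK, hTK⟩ := iInf_lt_iff.1 hK
  have h1 : ‖T + K‖ < c := by
    rw [← ofReal_norm] at hTK
    exact (ENNReal.ofReal_lt_ofReal_iff_of_nonneg (norm_nonneg _)).1 hTK
  have h2 := (h.tendsto_compact hK).norm
  rw [norm_zero] at h2
  filter_upwards [h2.eventually_le_const (mul_pos hM (sub_pos.2 h1))] with n hn
  have h3 : T (F n) = (T + K) (F n) - K (F n) := by simp
  rw [h3]
  have h4 := norm_sub_le ((T + K) (F n)) (K (F n))
  have h5 := (T + K).le_opNorm_of_le (h.norm_le n)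
  nlinarith

end Null

/-! ### Polynomial test functions and their rotations -/

/-- The double antiderivative `∑ aᵢ zⁱ⁺² / ((i + 1) (i + 2))` of `∑ aᵢ zⁱ`. -/
def testFun (S : Finset ℕ) (a : ℕ → ℝ) (z : ℂ) : ℂ :=
  ∑ i ∈ S, (a i / ((i + 1) * (i + 2)) : ℂ) * z ^ (i + 2)

/-- The antiderivative `∑ aᵢ zⁱ⁺¹ / (i + 1)` of `∑ aᵢ zⁱ`. -/
def testFunDeriv (S : Finset ℕ) (a : ℕ → ℝ) (z : ℂ) : ℂ :=
  ∑ i ∈ S, (a i / (i + 1) : ℂ) * z ^ (i + 1)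

lemma hasDerivAt_testFun (S : Finset ℕ) (a : ℕ → ℝ) (z : ℂ) :
    HasDerivAt (testFun S a) (testFunDeriv S a z) z := by
  refine HasDerivAt.fun_sum fun i _ => ?_
  refine ((hasDerivAt_pow (i + 2) z).const_mul _).congr_deriv ?_
  have h1 : (i + 1 : ℂ) ≠ 0 := by exact_mod_cast i.succ_ne_zero
  have h2 : (i + 2 : ℂ) ≠ 0 := by exact_mod_cast (i + 1).succ_ne_zero
  push_cast
  field_simp

lemma hasDerivAt_testFunDeriv (S : Finset ℕ) (a : ℕ → ℝ) (z : ℂ) :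
    HasDerivAt (testFunDeriv S a) (∑ i ∈ S, (a i : ℂ) * z ^ i) z := by
  refine HasDerivAt.fun_sum fun i _ => ?_
  refine ((hasDerivAt_pow (i + 1) z).const_mul _).congr_deriv ?_
  have h1 : (i + 1 : ℂ) ≠ 0 := by exact_mod_cast i.succ_ne_zero
  push_cast
  field_simp

lemma norm_sum_mul_pow_le {S : Finset ℕ} {a : ℕ → ℝ} (ha : ∀ i ∈ S, 0 ≤ a i) (z : ℂ) :
    ‖∑ i ∈ S, (a i : ℂ) * z ^ i‖ ≤ ∑ i ∈ S, a i * ‖z‖ ^ i := by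
  refine norm_sum_le_of_le S fun i hi => ?_
  rw [norm_mul, norm_pow, Complex.norm_real, Real.norm_of_nonneg (ha i hi)]

lemma weight_le_one {α : ℝ} (hα : 0 < α) {z : ℂ} (hz : z ∈ disc) : weight α z ≤ 1 := by
  have h := mem_disc.1 hz
  have h0 := norm_nonneg z
  exact Real.rpow_le_one (by nlinarith) (by nlinarith) hα.le

lemma exists_weight_le {α : ℝ} (hα : 0 < α) {ε : ℝ} (hε : 0 < ε) :
    ∃ ρ < 1, ∀ z ∈ disc, ρ < ‖z‖ → weight α z ≤ ε := by
  have hc : ContinuousAt (fun t : ℝ => (1 - t ^ 2) ^ α) 1 :=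
    ContinuousAt.rpow_const (by fun_prop) (Or.inr hα.le)
  have h := hc.tendsto.eventually_lt_const (u := ε) (by simpa [hα.ne'] using hε)
  obtain ⟨δ, hδ, h⟩ := Metric.eventually_nhds_iff.1 h
  refine ⟨1 - δ, by linarith, fun z hz hzδ => (h ?_).le⟩
  have := mem_disc.1 hz
  rw [Real.dist_eq, abs_lt]
  constructor <;> linarith

section Lower

variable {α β : ℝ} {g φ : ℂ → ℂ} {T : Zygmund α →L[ℂ] Zygmund β}

/-- The estimate is needed uniformly in the rotation θ, since θ will later depend on z. For each n a
violating rotation is used if one exists. The rotated sequence is still null because its bounds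
involve only |z|, so for large n no rotation is violating. -/
lemma IsVolterraComp.eventually_le (hα : 0 < α) (hT : IsVolterraComp g φ T)
    (hφ : IsAnalyticSelfMap φ) (hg : IsAnalyticOnDisc g) {S : ℕ → Finset ℕ} {a : ℕ → ℕ → ℝ}
    (ha : ∀ n, ∀ i ∈ S n, 0 ≤ a n i) {M : ℝ} (hM0 : 0 < M)
    (hM : ∀ n, ∀ r : ℝ, 0 ≤ r → r < 1 → (1 - r ^ 2) ^ α * ∑ i ∈ S n, a n i * r ^ i ≤ M)
    (hl : ∀ r : ℝ, 0 ≤ r → r < 1 → Tendsto (fun n => ∑ i ∈ S n, a n i * r ^ i) atTop (nhds 0))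
    {c : ℝ} (hc : essNorm T < ENNReal.ofReal c) :
    ∀ᶠ n in atTop, ∀ θ : ℂ, ‖θ‖ = 1 → ∀ z ∈ disc,
      weight β z * ‖deriv g z * deriv φ z * (θ * testFunDeriv (S n) (a n) (θ * φ z)) +
        deriv (deriv g) z * testFun (S n) (a n) (θ * φ z)‖ ≤ M * c := by
  set bad : ℕ → ℂ → Prop := fun n θ => ¬ ∀ z ∈ disc,
      weight β z * ‖deriv g z * deriv φ z * (θ * testFunDeriv (S n) (a n) (θ * φ z)) +
        deriv (deriv g) z * testFun (S n) (a n) (θ * φ z)‖ ≤ M * c with hbad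
  have hex : ∀ n, ∃ θ : ℂ, ‖θ‖ = 1 ∧ ((∃ θ' : ℂ, ‖θ'‖ = 1 ∧ bad n θ') → bad n θ) := by
    intro n
    by_cases h : ∃ θ' : ℂ, ‖θ'‖ = 1 ∧ bad n θ'
    · obtain ⟨θ, h1, h2⟩ := h
      exact ⟨θ, h1, fun _ => h2⟩
    · exact ⟨1, norm_one, fun h' => (h h').elim⟩
  choose θ hθ hθbad using hex
  have hle : ∀ n z, ‖θ n ^ 2 * ∑ i ∈ S n, (a n i : ℂ) * (θ n * z) ^ i‖
      ≤ ∑ i ∈ S n, a n i * ‖z‖ ^ i := by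
    intro n z
    rw [norm_mul, norm_pow, hθ, one_pow, one_mul]
    refine (norm_sum_mul_pow_le (ha n) _).trans_eq ?_
    rw [norm_mul, hθ, one_mul]
  have hF : ∀ n, ∃ F : Zygmund α, ∀ z ∈ disc, F z = testFun (S n) (a n) (θ n * z) ∧
      deriv F z = θ n * testFunDeriv (S n) (a n) (θ n * z) ∧
      deriv (deriv F) z = θ n ^ 2 * ∑ i ∈ S n, (a n i : ℂ) * (θ n * z) ^ i := by
    intro n
    have hm : ∀ z : ℂ, HasDerivAt (fun z => θ n * z) (θ n) z := fun z => by
      simpa using (hasDerivAt_id z).const_mul (θ n)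
    refine Zygmund.exists_eqOn (M := M) (fun z _ => ?_) (fun z _ => ?_) (fun z hz => ?_)
    · exact ((hasDerivAt_testFun _ _ _).comp z (hm z)).congr_deriv (mul_comm _ _)
    · exact (((hasDerivAt_testFunDeriv _ _ _).comp z (hm z)).const_mul (θ n)).congr_deriv (by ring)
    · exact (mul_le_mul_of_nonneg_left (hle n z) (weight_pos α hz).le).trans
        (hM n ‖z‖ (norm_nonneg z) (mem_disc.1 hz))
  choose F hF using hF
  have hmono : ∀ n, ∀ r s : ℝ, 0 ≤ r → r ≤ s →
      ∑ i ∈ S n, a n i * r ^ i ≤ ∑ i ∈ S n, a n i * s ^ i := fun n r s hr hrs =>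
    Finset.sum_le_sum fun i hi =>
      mul_le_mul_of_nonneg_left (pow_le_pow_left₀ hr hrs i) (ha n i hi)
  have hsum : ∀ n, ∀ r : ℝ, 0 ≤ r → 0 ≤ ∑ i ∈ S n, a n i * r ^ i := fun n r hr =>
    Finset.sum_nonneg fun i hi => mul_nonneg (ha n i hi) (pow_nonneg hr i)
  have hnull : IsNullSeq F M :=
    { apply_zero := fun n => by
        rw [(hF n 0 zero_mem_disc).1]
        simp [testFun]
      deriv_zero := fun n => by
        rw [(hF n 0 zero_mem_disc).2.1]
        simp [testFunDeriv]
      bound := fun n z hz => by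
        rw [(hF n z hz).2.2]
        exact (mul_le_mul_of_nonneg_left (hle n z) (weight_pos α hz).le).trans
          (hM n ‖z‖ (norm_nonneg z) (mem_disc.1 hz))
      -- Each test function is a polynomial, so its second derivative is bounded on the disc and the
      -- weight alone gives decay at the boundary.
      boundary := fun n ε hε => by
        have hB := hsum n 1 zero_le_one
        set B := ∑ i ∈ S n, a n i * 1 ^ i
        obtain ⟨ρ, hρ, h⟩ := exists_weight_le hα (ε := ε / (B + 1)) (by positivity)
        refine ⟨ρ, hρ, fun z hz hzρ => ?_⟩
        rw [(hF n z hz).2.2]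
        have h1 : ‖θ n ^ 2 * ∑ i ∈ S n, (a n i : ℂ) * (θ n * z) ^ i‖ ≤ B + 1 :=
          (hle n z).trans ((hmono n _ 1 (norm_nonneg z) (mem_disc.1 hz).le).trans (by linarith))
        calc _ ≤ ε / (B + 1) * (B + 1) := by
              gcongr
              exact h z hz hzρ
          _ = ε := by field_simp
      locally := fun ρ hρ ε hε => by
        filter_upwards [(hl (max ρ 0) (le_max_right _ _) (max_lt hρ one_pos)).eventually_le_const hε]
          with n hn z hz hzρ
        rw [(hF n z hz).2.2]
        calc _ ≤ 1 * ε := by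
              gcongr
              · exact weight_le_one hα hz
              · exact (hle n z).trans ((hmono n _ _ (norm_nonneg z)
                  (hzρ.trans (le_max_left _ _))).trans hn)
          _ = ε := one_mul ε }
  filter_upwards [hnull.eventually_norm_le hM0 hc] with n hn θ' hθ'
  by_contra hcon
  refine hθbad n ⟨θ', hθ', hcon⟩ fun z hz => ?_
  have h1 := hT.weight_mul_le hφ hg (F n) hz
  rw [(hF n _ (hφ.2 hz)).1, (hF n _ (hφ.2 hz)).2.1] at h1
  exact h1.trans hn

lemma exists_rotation (z : ℂ) : ∃ θ : ℂ, ‖θ‖ = 1 ∧ θ * z = (‖z‖ : ℂ) := by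
  by_cases hz : z = 0
  · exact ⟨1, norm_one, by simp [hz]⟩
  · have h : (‖z‖ : ℂ) ≠ 0 := by simpa using hz
    refine ⟨‖z‖ / z, ?_, by field_simp⟩
    rw [norm_div, Complex.norm_real, norm_norm, div_self (by simpa using hz)]

/-- Rotating so that θφ(z) = |φ(z)| makes both values of the test function nonnegative reals, with
no cancellation inside the sums. The triangle inequality then bounds each of the two terms by the
other. -/
lemma IsVolterraComp.eventually_le_add (hα : 0 < α) (hT : IsVolterraComp g φ T)
    (hφ : IsAnalyticSelfMap φ) (hg : IsAnalyticOnDisc g) {S : ℕ → Finset ℕ} {a : ℕ → ℕ → ℝ}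
    (ha : ∀ n, ∀ i ∈ S n, 0 ≤ a n i) {M : ℝ} (hM0 : 0 < M)
    (hM : ∀ n, ∀ r : ℝ, 0 ≤ r → r < 1 → (1 - r ^ 2) ^ α * ∑ i ∈ S n, a n i * r ^ i ≤ M)
    (hl : ∀ r : ℝ, 0 ≤ r → r < 1 → Tendsto (fun n => ∑ i ∈ S n, a n i * r ^ i) atTop (nhds 0))
    {c : ℝ} (hc : essNorm T < ENNReal.ofReal c) :
    ∀ᶠ n in atTop, ∀ z ∈ disc,
      weight β z * ‖deriv g z * deriv φ z‖ * (∑ i ∈ S n, a n i / (i + 1) * ‖φ z‖ ^ (i + 1)) ≤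
        M * c + weight β z * ‖deriv (deriv g) z‖ *
          ∑ i ∈ S n, a n i / ((i + 1) * (i + 2)) * ‖φ z‖ ^ (i + 2) ∧
      weight β z * ‖deriv (deriv g) z‖ *
          (∑ i ∈ S n, a n i / ((i + 1) * (i + 2)) * ‖φ z‖ ^ (i + 2)) ≤
        M * c + weight β z * ‖deriv g z * deriv φ z‖ *
          ∑ i ∈ S n, a n i / (i + 1) * ‖φ z‖ ^ (i + 1) := by
  filter_upwards [hT.eventually_le hα hφ hg ha hM0 hM hl hc] with n hn z hz
  obtain ⟨θ, hθ, hθz⟩ := exists_rotation (φ z)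
  have h := hn θ hθ z hz
  rw [hθz] at h
  have e1 : testFunDeriv (S n) (a n) ‖φ z‖ =
      ((∑ i ∈ S n, a n i / (i + 1) * ‖φ z‖ ^ (i + 1) : ℝ) : ℂ) := by
    simp [testFunDeriv]
  have e0 : testFun (S n) (a n) ‖φ z‖ =
      ((∑ i ∈ S n, a n i / ((i + 1) * (i + 2)) * ‖φ z‖ ^ (i + 2) : ℝ) : ℂ) := by
    simp [testFun]
  rw [e1, e0] at h
  have p1 : 0 ≤ ∑ i ∈ S n, a n i / (i + 1) * ‖φ z‖ ^ (i + 1) := Finset.sum_nonneg fun i hi =>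
    mul_nonneg (div_nonneg (ha n i hi) (by positivity)) (by positivity)
  have p0 : 0 ≤ ∑ i ∈ S n, a n i / ((i + 1) * (i + 2)) * ‖φ z‖ ^ (i + 2) :=
    Finset.sum_nonneg fun i hi =>
      mul_nonneg (div_nonneg (ha n i hi) (by positivity)) (by positivity)
  set X1 := ∑ i ∈ S n, a n i / (i + 1) * ‖φ z‖ ^ (i + 1)
  set X0 := ∑ i ∈ S n, a n i / ((i + 1) * (i + 2)) * ‖φ z‖ ^ (i + 2)
  have q1 : ‖deriv g z * deriv φ z * (θ * X1)‖ = ‖deriv g z * deriv φ z‖ * X1 := by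
    rw [norm_mul, norm_mul θ, hθ, one_mul, Complex.norm_real, Real.norm_of_nonneg p1]
  have q0 : ‖deriv (deriv g) z * X0‖ = ‖deriv (deriv g) z‖ * X0 := by
    rw [norm_mul, Complex.norm_real, Real.norm_of_nonneg p0]
  have hw := (weight_pos β hz).le
  have t1 := norm_sub_le (deriv g z * deriv φ z * (θ * X1) + deriv (deriv g) z * X0)
    (deriv (deriv g) z * X0)
  have t0 := norm_sub_le (deriv g z * deriv φ z * (θ * X1) + deriv (deriv g) z * X0)
    (deriv g z * deriv φ z * (θ * X1))
  rw [add_sub_cancel_right, q1, q0] at t1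
  rw [add_sub_cancel_left, q1, q0] at t0
  constructor
  · have := mul_le_mul_of_nonneg_left t1 hw
    linarith
  · have := mul_le_mul_of_nonneg_left t0 hw
    linarith

end Lower

/-! ### Monomials and the power limsups -/

lemma rpow_le_mul_exp {α t : ℝ} (hα : 0 < α) (ht : 0 ≤ t) : t ^ α ≤ α ^ α * Real.exp t := by
  have h1 : t ≤ α * Real.exp (t / α) := by
    have := Real.add_one_le_exp (t / α)
    calc t = α * (t / α) := by field_simp
      _ ≤ α * Real.exp (t / α) := by
        gcongr
        linarith
  calc t ^ α ≤ (α * Real.exp (t / α)) ^ α := Real.rpow_le_rpow ht h1 hα.le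
    _ = α ^ α * Real.exp t := by
      rw [Real.mul_rpow hα.le (Real.exp_nonneg _), ← Real.exp_mul]
      congr 2
      field_simp

lemma pow_le_exp_neg {r : ℝ} (hr : 0 ≤ r) (n : ℕ) : r ^ n ≤ Real.exp (-(n * (1 - r))) := by
  have h : r ≤ Real.exp (r - 1) := by
    have := Real.add_one_le_exp (r - 1)
    linarith
  calc r ^ n ≤ Real.exp (r - 1) ^ n := pow_le_pow_left₀ hr h n
    _ = Real.exp (-(n * (1 - r))) := by
      rw [← Real.exp_nat_mul]
      ring_nf

/-- The coefficient for which `testFun {n} (monomialCoeff α)` is `(n + 2)^(α - 2) zⁿ⁺²`. -/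
def monomialCoeff (α : ℝ) (i : ℕ) : ℝ := ((i : ℝ) + 2) ^ (α - 2) * ((i + 1) * (i + 2))

lemma monomialCoeff_nonneg (α : ℝ) (i : ℕ) : 0 ≤ monomialCoeff α i := by
  unfold monomialCoeff
  positivity

/-- The coefficient is at most (n+2)^α, and t^α ≤ α^α e^t at t = (n+2)(1-r) is offset by r^n ≤
e^(-n(1-r)), leaving e^(2(1-r)) ≤ e². -/
lemma exists_monomialCoeff_bound {α : ℝ} (hα : 0 < α) :
    ∃ M : ℝ, 0 < M ∧ ∀ n : ℕ, ∀ r : ℝ, 0 ≤ r → r < 1 →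
      (1 - r ^ 2) ^ α * (monomialCoeff α n * r ^ n) ≤ M := by
  refine ⟨2 ^ α * (α ^ α * Real.exp 2), by positivity, fun n r hr hr1 => ?_⟩
  have h1 : (1 - r ^ 2) ^ α ≤ (2 * (1 - r)) ^ α :=
    Real.rpow_le_rpow (by nlinarith) (by nlinarith) hα.le
  have h2 : monomialCoeff α n ≤ ((n : ℝ) + 2) ^ α := by
    have e : ((n : ℝ) + 2) ^ α = ((n : ℝ) + 2) ^ (α - 2) * ((n + 2) * (n + 2)) := by
      rw [← sq, ← Real.rpow_natCast, ← Real.rpow_add (by positivity)]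
      norm_num
    rw [e]
    unfold monomialCoeff
    gcongr
    norm_num
  have h3 := rpow_le_mul_exp hα (t := (n + 2) * (1 - r))
    (mul_nonneg (by positivity) (by linarith))
  have hr2 : 0 ≤ 1 - r := by linarith
  have hr3 : 0 ≤ 1 - r ^ 2 := by nlinarith
  calc (1 - r ^ 2) ^ α * (monomialCoeff α n * r ^ n)
      ≤ (2 * (1 - r)) ^ α * (((n : ℝ) + 2) ^ α * Real.exp (-(n * (1 - r)))) :=
        mul_le_mul h1 (mul_le_mul h2 (pow_le_exp_neg hr n) (by positivity) (by positivity))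
          (mul_nonneg (monomialCoeff_nonneg α n) (by positivity)) (by positivity)
    _ = 2 ^ α * ((((n : ℝ) + 2) * (1 - r)) ^ α * Real.exp (-(n * (1 - r)))) := by
        rw [Real.mul_rpow (by norm_num) hr2, Real.mul_rpow (by positivity) hr2]
        ring
    _ ≤ 2 ^ α * (α ^ α * Real.exp ((n + 2) * (1 - r)) * Real.exp (-(n * (1 - r)))) := by
        gcongr
    _ = 2 ^ α * (α ^ α * Real.exp (2 * (1 - r))) := by
        rw [mul_assoc (α ^ α), ← Real.exp_add]
        ring_nf
    _ ≤ 2 ^ α * (α ^ α * Real.exp 2) := by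
        gcongr
        linarith

lemma tendsto_monomialCoeff {α : ℝ} (hα : 0 < α) {r : ℝ} (hr : 0 ≤ r) (hr1 : r < 1) :
    Tendsto (fun n => monomialCoeff α n * r ^ n) atTop (nhds 0) := by
  obtain ⟨M, hM, h⟩ := exists_monomialCoeff_bound hα
  -- The uniform bound at an intermediate radius s leaves the geometric factor (r/s)^n.
  set s := (r + 1) / 2 with hs
  have hs0 : 0 < s := by positivity
  have hs1 : s < 1 := by linarith
  have hw : 0 < (1 - s ^ 2) ^ α := Real.rpow_pos_of_pos (by nlinarith) _
  have ht := (tendsto_pow_atTop_nhds_zero_of_lt_one (r := r / s) (by positivity)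
    ((div_lt_one hs0).2 (by linarith))).const_mul (M / (1 - s ^ 2) ^ α)
  rw [mul_zero] at ht
  refine squeeze_zero (fun n => mul_nonneg (monomialCoeff_nonneg α n) (by positivity))
    (fun n => ?_) ht
  have h1 : monomialCoeff α n * s ^ n ≤ M / (1 - s ^ 2) ^ α := by
    rw [le_div_iff₀ hw, mul_comm]
    exact h n s hs0.le hs1
  calc monomialCoeff α n * r ^ n = monomialCoeff α n * s ^ n * (r / s) ^ n := by
        rw [mul_assoc, ← mul_pow, mul_div_assoc', mul_div_cancel_left₀ _ hs0.ne']
    _ ≤ _ := by gcongr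

lemma rpow_sub_one_eq {t : ℝ} (ht : 0 < t) (α : ℝ) : t ^ (α - 1) = t ^ (α - 2) * t := by
  rw [← Real.rpow_add_one ht.ne']
  ring_nf

/-- For α < 2 the g''-term of the m-th monomial carries (m+2)^(α-2), which tends to zero. It is
eventually at most c, and this accounts for the 1 in M + 1. -/
theorem exists_lower_pow_of_lt_two {α : ℝ} (β : ℝ) (h1 : 1 < α) (h2 : α < 2) :
    ∃ C : ℝ, 0 < C ∧ ∀ (φ g : ℂ → ℂ), IsAnalyticSelfMap φ → IsAnalyticOnDisc g →
      ∀ T : Zygmund α →L[ℂ] Zygmund β, IsVolterraComp g φ T →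
      ∀ c : ℝ, essNorm T < ENNReal.ofReal c → ∀ᶠ n : ℕ in atTop, ∀ z ∈ disc,
        ((n : ℝ) + 1) ^ (α - 1) * (weight β z * (‖deriv g z * deriv φ z‖ * ‖φ z‖ ^ n)) ≤ C * c := by
  have hα : 0 < α := by linarith
  obtain ⟨M, hM, hMb⟩ := exists_monomialCoeff_bound hα
  refine ⟨M + 1, by positivity, fun φ g hφ hg T hT c hc => ?_⟩
  have hc0 : 0 < c := ENNReal.ofReal_pos.1 (pos_of_gt hc)
  obtain ⟨B, hB, hBz⟩ := hT.exists_bound hφ hg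
  have key := hT.eventually_le_add hα hφ hg (S := fun n => {n}) (a := fun _ => monomialCoeff α)
    (fun n i _ => monomialCoeff_nonneg α i) hM (fun n r hr hr1 => by simpa using hMb n r hr hr1)
    (fun r hr hr1 => by simpa using tendsto_monomialCoeff hα hr hr1) hc
  have hdec : Tendsto (fun n : ℕ => B * ((n : ℝ) + 2) ^ (α - 2)) atTop (nhds 0) := by
    have := (tendsto_rpow_neg_atTop (y := 2 - α) (by linarith)).comp
      (tendsto_atTop_add_const_right atTop (2 : ℝ) tendsto_natCast_atTop_atTop)
    simpa [Function.comp_def] using this.const_mul B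
  obtain ⟨n₀, hn₀⟩ := eventually_atTop.1 (key.and (hdec.eventually_le_const hc0))
  filter_upwards [eventually_ge_atTop (n₀ + 1)] with n hn z hz
  -- The derivative of the test monomial z^(m+2) has exponent m+1, so index m serves the exponent n
  -- = m+1.
  obtain ⟨m, rfl⟩ : ∃ m, n = m + 1 := ⟨n - 1, by lia⟩
  obtain ⟨h3, h4⟩ := hn₀ m (by lia)
  have h5 := (h3 z hz).1
  simp only [Finset.sum_singleton] at h5
  have hm1 : ((m : ℝ) + 1) ≠ 0 := by positivity
  have hm2 : ((m : ℝ) + 2) ≠ 0 := by positivity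
  have e1 : monomialCoeff α m / ((m : ℝ) + 1) = ((m : ℝ) + 2) ^ (α - 1) := by
    rw [rpow_sub_one_eq (by positivity), monomialCoeff]
    field_simp
  have e0 : monomialCoeff α m / (((m : ℝ) + 1) * (m + 2)) = ((m : ℝ) + 2) ^ (α - 2) := by
    rw [monomialCoeff]
    field_simp
  rw [e1, e0] at h5
  have h6 : weight β z * ‖deriv (deriv g) z‖ * (((m : ℝ) + 2) ^ (α - 2) * ‖φ z‖ ^ (m + 2))
      ≤ B * ((m : ℝ) + 2) ^ (α - 2) := by
    have h7 : ‖φ z‖ ^ (m + 2) ≤ 1 :=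
      pow_le_one₀ (norm_nonneg _) (mem_disc.1 (hφ.2 hz)).le
    have h8 := (hBz z hz).2
    have h9 : 0 ≤ ((m : ℝ) + 2) ^ (α - 2) := by positivity
    exact mul_le_mul h8 (mul_le_of_le_one_right h9 h7) (by positivity) hB.le
  have e2 : (((m + 1 : ℕ) : ℝ) + 1) = (m : ℝ) + 2 := by
    push_cast
    ring
  rw [e2]
  linarith

/-- Here the g''-term need not be negligible. With D(m) the second derivative of the image of
z^(m+1), the combination D(2m+1) - φ^(m+1)·D(m) eliminates g'' and leaves (m+1)φ^(2m+1)u. This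
bounds u, and D(k) then bounds g''. -/
theorem exists_lower_pow_of_two_le {α : ℝ} (β : ℝ) (h2 : 2 ≤ α) :
    ∃ C : ℝ, 0 < C ∧ ∀ (φ g : ℂ → ℂ), IsAnalyticSelfMap φ → IsAnalyticOnDisc g →
      ∀ T : Zygmund α →L[ℂ] Zygmund β, IsVolterraComp g φ T →
      ∀ c : ℝ, essNorm T < ENNReal.ofReal c → ∀ᶠ n : ℕ in atTop, ∀ z ∈ disc,
        ((n : ℝ) + 1) ^ (α - 1) * (weight β z * (‖deriv g z * deriv φ z‖ * ‖φ z‖ ^ n)) ≤ C * c ∧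
        ((n : ℝ) + 1) ^ (α - 2) * (weight β z * (‖deriv (deriv g) z‖ * ‖φ z‖ ^ n)) ≤ C * c := by
  have hα : 0 < α := by linarith
  obtain ⟨M, hM, hMb⟩ := exists_monomialCoeff_bound hα
  set A : ℝ := 3 ^ (α - 1) * (2 * M) with hA
  have hA0 : 0 < A := by positivity
  have h2α : (1 : ℝ) ≤ 2 ^ (α - 2) := Real.one_le_rpow (by norm_num) (by linarith)
  refine ⟨2 ^ (α - 2) * (M + A), by positivity, fun φ g hφ hg T hT c hc => ?_⟩
  have hc0 : 0 < c := ENNReal.ofReal_pos.1 (pos_of_gt hc)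
  have key := hT.eventually_le hα hφ hg (S := fun n => {n}) (a := fun _ => monomialCoeff α)
    (fun n i _ => monomialCoeff_nonneg α i) hM (fun n r hr hr1 => by simpa using hMb n r hr hr1)
    (fun r hr hr1 => by simpa using tendsto_monomialCoeff hα hr hr1) hc
  obtain ⟨n₀, hn₀⟩ := eventually_atTop.1 key
  -- the monomial test functions, with the factor `(m + 1)^(α - 2)` taken out
  have hD : ∀ m ≥ n₀ + 1, ∀ z ∈ disc, ((m : ℝ) + 1) ^ (α - 2) * (weight β z *
      ‖deriv g z * deriv φ z * ((m + 1) * φ z ^ m) + deriv (deriv g) z * φ z ^ (m + 1)‖)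
      ≤ M * c := by
    intro m hm z hz
    obtain ⟨n, rfl⟩ : ∃ n, m = n + 1 := ⟨m - 1, by lia⟩
    have h := hn₀ n (by lia) 1 norm_one z hz
    have p : 0 ≤ (((n + 1 : ℕ) : ℝ) + 1) ^ (α - 2) := by positivity
    refine le_trans (le_of_eq ?_) h
    rw [mul_left_comm]
    congr 1
    conv_lhs => rw [← Real.norm_of_nonneg p, ← Complex.norm_real, ← norm_mul]
    congr 1
    have hm1 : ((n : ℂ) + 1) ≠ 0 := by exact_mod_cast n.succ_ne_zero
    have hm2 : ((n : ℂ) + 2) ≠ 0 := by exact_mod_cast (n + 1).succ_ne_zero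
    have e2 : (((n + 1 : ℕ) : ℝ) + 1) = (n : ℝ) + 2 := by
      push_cast
      ring
    rw [e2]
    simp only [testFun, testFunDeriv, Finset.sum_singleton, monomialCoeff, one_mul]
    push_cast
    field_simp
    ring
  have hu2 : ∀ m ≥ n₀ + 1, ∀ z ∈ disc, ((m : ℝ) + 1) ^ (α - 1) *
      (weight β z * (‖deriv g z * deriv φ z‖ * ‖φ z‖ ^ (2 * m + 1))) ≤ 2 * M * c := by
    intro m hm z hz
    have d1 := hD m hm z hz
    have d2 := hD (2 * m + 1) (by lia) z hz
    set D := fun m : ℕ =>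
      deriv g z * deriv φ z * ((m + 1) * φ z ^ m) + deriv (deriv g) z * φ z ^ (m + 1) with hDdef
    have p : 0 ≤ ((m : ℝ) + 1) ^ (α - 2) := by positivity
    have hw := (weight_pos β hz).le
    have e : deriv g z * deriv φ z * ((m + 1) * φ z ^ (2 * m + 1))
        = D (2 * m + 1) - φ z ^ (m + 1) * D m := by
      simp only [hDdef]
      push_cast
      ring
    have n1 : ‖φ z ^ (m + 1) * D m‖ ≤ ‖D m‖ := by
      rw [norm_mul, norm_pow]
      exact mul_le_of_le_one_left (norm_nonneg _)
        (pow_le_one₀ (norm_nonneg _) (mem_disc.1 (hφ.2 hz)).le)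
    have n2 : ‖deriv g z * deriv φ z‖ * ((m + 1) * ‖φ z‖ ^ (2 * m + 1)) ≤
        ‖D (2 * m + 1)‖ + ‖D m‖ := by
      have h1 : ‖((m : ℂ) + 1)‖ = (m : ℝ) + 1 := by
        rw [← Nat.cast_succ, Complex.norm_natCast, Nat.cast_succ]
      calc _ = ‖deriv g z * deriv φ z * ((m + 1) * φ z ^ (2 * m + 1))‖ := by
            rw [norm_mul (deriv g z * deriv φ z), norm_mul ((m : ℂ) + 1), norm_pow, h1]
        _ ≤ _ := by
            rw [e]
            exact (norm_sub_le _ _).trans (by linarith)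
    have n3 : ((m : ℝ) + 1) ^ (α - 2) ≤ (((2 * m + 1 : ℕ) : ℝ) + 1) ^ (α - 2) := by
      refine Real.rpow_le_rpow (by positivity) ?_ (by linarith)
      push_cast
      have : (0 : ℝ) ≤ m := m.cast_nonneg
      linarith
    have n4 : ((m : ℝ) + 1) ^ (α - 2) * (weight β z * ‖D (2 * m + 1)‖) ≤ M * c :=
      (mul_le_mul_of_nonneg_right n3 (by positivity)).trans d2
    rw [rpow_sub_one_eq (by positivity)]
    calc _ = ((m : ℝ) + 1) ^ (α - 2) * (weight β z *
          (‖deriv g z * deriv φ z‖ * ((m + 1) * ‖φ z‖ ^ (2 * m + 1)))) := by ring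
      _ ≤ ((m : ℝ) + 1) ^ (α - 2) * (weight β z * (‖D (2 * m + 1)‖ + ‖D m‖)) := by gcongr
      _ ≤ 2 * M * c := by
        rw [mul_add, mul_add]
        linarith
  have hu : ∀ k ≥ 2 * n₀ + 3, ∀ z ∈ disc, ((k : ℝ) + 1) ^ (α - 1) *
      (weight β z * (‖deriv g z * deriv φ z‖ * ‖φ z‖ ^ k)) ≤ A * c := by
    intro k hk z hz
    -- Only odd exponents 2m+1 have been reached so far. An arbitrary k exceeds one of them by at
    -- most 1, and k+1 ≤ 3(m+1) costs the factor 3^(α-1).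
    obtain ⟨m, hm1, hm2⟩ : ∃ m, 2 * m + 1 ≤ k ∧ k ≤ 2 * m + 2 := ⟨(k - 1) / 2, by lia, by lia⟩
    have h1 := hu2 m (by lia) z hz
    have hw := (weight_pos β hz).le
    have h3 : ((k : ℝ) + 1) ^ (α - 1) ≤ 3 ^ (α - 1) * ((m : ℝ) + 1) ^ (α - 1) := by
      rw [← Real.mul_rpow (by norm_num) (by positivity)]
      refine Real.rpow_le_rpow (by positivity) ?_ (by linarith)
      have : (k : ℝ) ≤ 2 * m + 2 := by exact_mod_cast hm2
      have : (0 : ℝ) ≤ m := m.cast_nonneg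
      linarith
    have h4 : ‖φ z‖ ^ k ≤ ‖φ z‖ ^ (2 * m + 1) :=
      pow_le_pow_of_le_one (norm_nonneg _) (mem_disc.1 (hφ.2 hz)).le hm1
    calc _ ≤ (3 ^ (α - 1) * ((m : ℝ) + 1) ^ (α - 1)) *
          (weight β z * (‖deriv g z * deriv φ z‖ * ‖φ z‖ ^ (2 * m + 1))) := by gcongr
      _ = 3 ^ (α - 1) * (((m : ℝ) + 1) ^ (α - 1) *
          (weight β z * (‖deriv g z * deriv φ z‖ * ‖φ z‖ ^ (2 * m + 1)))) := by ring
      _ ≤ 3 ^ (α - 1) * (2 * M * c) := by gcongr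
      _ = A * c := by
        rw [hA]
        ring
  have hAC : A * c ≤ 2 ^ (α - 2) * (M + A) * c := by
    gcongr
    nlinarith
  filter_upwards [eventually_ge_atTop (2 * n₀ + 4)] with n hn z hz
  refine ⟨(hu n (by lia) z hz).trans hAC, ?_⟩
  obtain ⟨k, rfl⟩ : ∃ k, n = k + 1 := ⟨n - 1, by lia⟩
  have h1 := hD k (by lia) z hz
  have h3 := hu k (by lia) z hz
  have hw := (weight_pos β hz).le
  have p : 0 ≤ ((k : ℝ) + 1) ^ (α - 2) := by positivity
  have hk1 : ‖((k : ℂ) + 1)‖ = (k : ℝ) + 1 := by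
    rw [← Nat.cast_succ, Complex.norm_natCast, Nat.cast_succ]
  have h4 : ‖deriv (deriv g) z‖ * ‖φ z‖ ^ (k + 1) ≤
      ‖deriv g z * deriv φ z * ((k + 1) * φ z ^ k) + deriv (deriv g) z * φ z ^ (k + 1)‖ +
      ‖deriv g z * deriv φ z‖ * ((k + 1) * ‖φ z‖ ^ k) := by
    have h5 := norm_sub_le
      (deriv g z * deriv φ z * ((k + 1) * φ z ^ k) + deriv (deriv g) z * φ z ^ (k + 1))
      (deriv g z * deriv φ z * ((k + 1) * φ z ^ k))
    rwa [add_sub_cancel_left, norm_mul (deriv (deriv g) z), norm_pow,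
      norm_mul (deriv g z * deriv φ z), norm_mul ((k : ℂ) + 1), norm_pow, hk1] at h5
  have h6 : ((k : ℝ) + 1) ^ (α - 2) * (weight β z * (‖deriv (deriv g) z‖ * ‖φ z‖ ^ (k + 1)))
      ≤ (M + A) * c := by
    have h7 := mul_le_mul_of_nonneg_left (mul_le_mul_of_nonneg_left h4 hw) p
    rw [rpow_sub_one_eq (by positivity)] at h3
    nlinarith
  have h8 : (((k + 1 : ℕ) : ℝ) + 1) ^ (α - 2) ≤ 2 ^ (α - 2) * ((k : ℝ) + 1) ^ (α - 2) := by
    rw [← Real.mul_rpow (by norm_num) (by positivity)]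
    refine Real.rpow_le_rpow (by positivity) ?_ (by linarith)
    push_cast
    have : (0 : ℝ) ≤ k := k.cast_nonneg
    linarith
  calc _ ≤ (2 ^ (α - 2) * ((k : ℝ) + 1) ^ (α - 2)) *
        (weight β z * (‖deriv (deriv g) z‖ * ‖φ z‖ ^ (k + 1))) := by gcongr
    _ = 2 ^ (α - 2) * (((k : ℝ) + 1) ^ (α - 2) *
        (weight β z * (‖deriv (deriv g) z‖ * ‖φ z‖ ^ (k + 1)))) := by ring
    _ ≤ 2 ^ (α - 2) * ((M + A) * c) := by gcongr
    _ = _ := by ring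

/-! ### Blocks of monomials and the logarithmic limsups -/

/-- For this exponent n one has n(1-r) ≤ 2, and log r ≥ -2(1-r) for r ≥ 1/2; together n·log r ≥ -4.
-/
lemma exp_neg_four_le_pow {r : ℝ} (hr : 1 / 2 ≤ r) (hr1 : r < 1) :
    Real.exp (-4) ≤ r ^ ⌈1 / (1 - r)⌉₊ := by
  have h0 : 0 < r := by linarith
  have h1 : 0 < 1 - r := by linarith
  set n := ⌈1 / (1 - r)⌉₊
  have hn : (n : ℝ) * (1 - r) ≤ 2 := by
    have := (Nat.ceil_lt_add_one (by positivity : 0 ≤ 1 / (1 - r))).le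
    calc (n : ℝ) * (1 - r) ≤ (1 / (1 - r) + 1) * (1 - r) := by gcongr
      _ = 1 + (1 - r) := by field_simp
      _ ≤ 2 := by linarith
  have hlog : -(2 * (1 - r)) ≤ Real.log r := by
    have h2 := Real.one_sub_inv_le_log_of_pos h0
    have h3 : r⁻¹ - 1 ≤ 2 * (1 - r) := by
      rw [sub_le_iff_le_add, inv_le_iff_one_le_mul₀ h0]
      nlinarith
    linarith
  rw [← Real.exp_log h0, ← Real.exp_nat_mul, Real.exp_le_exp]
  have hn0 : (0 : ℝ) ≤ n := n.cast_nonneg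
  nlinarith

/-- The size of n·r^n is of order 1/(1-r) at n ≈ 1/(1-r). If that index lies below m, then n = m
already suffices. -/
lemma exists_pow_div_le {r : ℝ} (hr : 0 ≤ r) (hr1 : r < 1) {m : ℕ} (hm : 2 ≤ m) :
    ∃ n ≥ m, r ^ m / (1 - r) ≤ Real.exp 4 * (n * r ^ n) := by
  have h1 : 0 < 1 - r := by linarith
  have hm0 : (2 : ℝ) ≤ m := by exact_mod_cast hm
  rcases le_or_gt (1 / (1 - r)) m with h | h
  · refine ⟨m, le_rfl, ?_⟩
    have : 1 ≤ Real.exp 4 := Real.one_le_exp (by norm_num)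
    calc r ^ m / (1 - r) = 1 / (1 - r) * r ^ m := by ring
      _ ≤ 1 * (m * r ^ m) := by
        rw [one_mul]
        gcongr
      _ ≤ _ := by gcongr
  · have hr2 : 1 / 2 ≤ r := by
      rw [lt_div_iff₀ h1] at h
      nlinarith
    refine ⟨⌈1 / (1 - r)⌉₊, ?_, ?_⟩
    · have := h.le.trans (Nat.le_ceil (1 / (1 - r)))
      exact_mod_cast this
    · have h3 := exp_neg_four_le_pow hr2 hr1
      have h4 := Nat.le_ceil (1 / (1 - r))
      set n := ⌈1 / (1 - r)⌉₊
      calc r ^ m / (1 - r) ≤ 1 / (1 - r) := by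
            gcongr
            exact pow_le_one₀ hr hr1.le
        _ ≤ n := h4
        _ = Real.exp 4 * (n * Real.exp (-4)) := by
            rw [mul_left_comm, ← Real.exp_add]
            simp
        _ ≤ _ := by gcongr

lemma log_sub_log_le_sum (m N : ℕ) (h : m ≤ N) :
    Real.log (N + 2) - Real.log (m + 2) ≤ ∑ i ∈ Finset.Ico m N, 1 / ((i : ℝ) + 2) := by
  induction N, h using Nat.le_induction with
  | base => simp
  | succ N h ih =>
    rw [Finset.sum_Ico_succ_top h]
    have h1 : (0 : ℝ) < N + 2 := by positivity
    have h2 : (0 : ℝ) < N + 3 := by positivity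
    have h3 : Real.log (N + 3) - Real.log (N + 2) ≤ 1 / ((N : ℝ) + 2) := by
      rw [← Real.log_div h2.ne' h1.ne']
      refine (Real.log_le_sub_one_of_pos (by positivity)).trans_eq ?_
      field_simp
      ring
    push_cast
    rw [show (N : ℝ) + 1 + 2 = N + 3 by ring]
    linarith

/-- With m = ⌊√(n-1)⌋ all exponents satisfy i+2 ≤ m²+1 ≤ n, so r^n can be taken out of the block.
The remaining harmonic sum is at least log(m²+2) - log(m+2) ≥ (log m)/2, and log n ≤ 4 log m; the
product of the losses is 8. -/
lemma log_mul_pow_le_sum {r : ℝ} (hr : 0 ≤ r) (hr1 : r ≤ 1) {n : ℕ} (hn : 5 ≤ n) :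
    Real.log n * r ^ n ≤ 8 * ∑ i ∈ Finset.Ico (Nat.sqrt (n - 1)) (Nat.sqrt (n - 1) ^ 2),
      1 / ((i : ℝ) + 2) * r ^ (i + 2) := by
  have hm : 2 ≤ Nat.sqrt (n - 1) := Nat.le_sqrt.2 (by lia)
  have hm1 : Nat.sqrt (n - 1) ^ 2 ≤ n - 1 := Nat.sqrt_le' _
  have hm2 : n - 1 < (Nat.sqrt (n - 1) + 1) ^ 2 := Nat.lt_succ_sqrt' _
  set m := Nat.sqrt (n - 1)
  have hmR : (2 : ℝ) ≤ m := by exact_mod_cast hm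
  have hlog : Real.log n ≤ 4 * Real.log m := by
    have : n ≤ m ^ 4 := by
      have h1 : n ≤ (m + 1) ^ 2 := by lia
      have h2 : m + 1 ≤ m ^ 2 := by nlinarith
      calc n ≤ (m + 1) ^ 2 := h1
        _ ≤ (m ^ 2) ^ 2 := Nat.pow_le_pow_left h2 2
        _ = m ^ 4 := by ring
    have h3 : Real.log n ≤ Real.log ((m : ℝ) ^ 4) :=
      Real.log_le_log (by exact_mod_cast (by lia : 0 < n)) (by exact_mod_cast this)
    simpa [Real.log_pow] using h3
  have hhalf : Real.log m ≤ 2 * (Real.log ((m ^ 2 : ℕ) + 2) - Real.log (m + 2)) := by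
    have h0 : (m : ℝ) * (m + 2) ^ 2 ≤ ((m ^ 2 : ℕ) + 2) ^ 2 := by
      push_cast
      nlinarith [mul_nonneg (by linarith : (0 : ℝ) ≤ m - 2) (by positivity : (0 : ℝ) ≤ m ^ 3),
        mul_nonneg (by linarith : (0 : ℝ) ≤ m - 2) (by positivity : (0 : ℝ) ≤ m ^ 2),
        mul_nonneg (by linarith : (0 : ℝ) ≤ m - 2) (by positivity : (0 : ℝ) ≤ m)]
    have h1 := Real.log_le_log (by positivity) h0
    rw [Real.log_mul (by positivity) (by positivity), Real.log_pow, Real.log_pow] at h1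
    push_cast at h1 ⊢
    linarith
  have hsum := log_sub_log_le_sum m (m ^ 2) (by nlinarith)
  have hlow : (∑ i ∈ Finset.Ico m (m ^ 2), 1 / ((i : ℝ) + 2)) * r ^ n ≤
      ∑ i ∈ Finset.Ico m (m ^ 2), 1 / ((i : ℝ) + 2) * r ^ (i + 2) := by
    rw [Finset.sum_mul]
    refine Finset.sum_le_sum fun i hi => ?_
    have := (Finset.mem_Ico.1 hi).2
    gcongr ?_ * ?_
    exact pow_le_pow_of_le_one hr hr1 (by lia)
  have hrn : 0 ≤ r ^ n := pow_nonneg hr n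
  calc Real.log n * r ^ n ≤
      (8 * ∑ i ∈ Finset.Ico m (m ^ 2), 1 / ((i : ℝ) + 2)) * r ^ n := by
        gcongr
        linarith
    _ ≤ _ := by linarith

lemma tendsto_sum_Ico_of_summable {f : ℕ → ℝ} (hf : ∀ i, 0 ≤ f i) (h : Summable f) (N : ℕ → ℕ) :
    Tendsto (fun m => ∑ i ∈ Finset.Ico m (N m), f i) atTop (nhds 0) := by
  refine squeeze_zero (fun m => Finset.sum_nonneg fun i _ => hf i) (fun m => ?_)
    (tendsto_sum_nat_add f)
  have hs : Summable fun k => f (k + m) := (summable_nat_add_iff m).2 h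
  rw [Finset.sum_Ico_eq_sum_range]
  simp_rw [add_comm m]
  exact hs.sum_le_tsum _ (fun i _ => hf _)

lemma hasSum_succ_mul_geometric {r : ℝ} (hr : 0 ≤ r) (hr1 : r < 1) :
    HasSum (fun i : ℕ => ((i : ℝ) + 1) * r ^ i) (1 / (1 - r) ^ 2) := by
  have h := hasSum_choose_mul_geometric_of_norm_lt_one 1
    (r := r) (by rwa [Real.norm_of_nonneg hr])
  simpa using h

lemma tendsto_sqrt_sub_one : Tendsto (fun n : ℕ => Nat.sqrt (n - 1)) atTop atTop := by
  refine tendsto_atTop.2 fun b => ?_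
  filter_upwards [eventually_ge_atTop (b * b + 1)] with n hn
  exact Nat.le_sqrt.2 (by lia)

/-- With unit coefficients the second derivative is a block of the geometric series, the first
derivative a harmonic block of size about log n, and the function itself is dominated by a tail of
the convergent series of 1/((i+1)(i+2)). The g''-term is thus eventually at most c, giving 2c + c
and the factor 3. -/
theorem exists_lower_log_one (β : ℝ) :
    ∃ C : ℝ, 0 < C ∧ ∀ (φ g : ℂ → ℂ), IsAnalyticSelfMap φ → IsAnalyticOnDisc g →
      ∀ T : Zygmund 1 →L[ℂ] Zygmund β, IsVolterraComp g φ T →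
      ∀ c : ℝ, essNorm T < ENNReal.ofReal c → ∀ᶠ n : ℕ in atTop, ∀ z ∈ disc,
        Real.log n * (weight β z * (‖deriv g z * deriv φ z‖ * ‖φ z‖ ^ n)) ≤ C * c := by
  refine ⟨8 * 3, by norm_num, fun φ g hφ hg T hT c hc => ?_⟩
  have hc0 : 0 < c := ENNReal.ofReal_pos.1 (pos_of_gt hc)
  obtain ⟨B, hB, hBz⟩ := hT.exists_bound hφ hg
  have key := hT.eventually_le_add one_pos hφ hg (S := fun m => Finset.Ico m (m ^ 2))
    (a := fun _ _ => 1) (fun _ _ _ => zero_le_one) (M := 2) two_pos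
    (fun n r hr hr1 => by
      have h1 : 0 < 1 - r := by linarith
      have h := sum_le_hasSum (Finset.Ico n (n ^ 2)) (fun i _ => pow_nonneg hr i)
        (hasSum_geometric_of_lt_one hr hr1)
      simp only [one_mul, Real.rpow_one]
      calc (1 - r ^ 2) * ∑ i ∈ Finset.Ico n (n ^ 2), r ^ i ≤ (1 - r ^ 2) * (1 - r)⁻¹ :=
            mul_le_mul_of_nonneg_left h (by nlinarith)
        _ = 1 + r := by
            field_simp
            ring
        _ ≤ 2 := by linarith)
    (fun r hr hr1 => by
      simpa using tendsto_sum_Ico_of_summable (fun i => pow_nonneg hr i)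
        (summable_geometric_of_lt_one hr hr1) (fun m => m ^ 2)) hc
  have hsum : Summable fun i : ℕ => 1 / (((i : ℝ) + 1) * (i + 2)) := by
    refine ((summable_nat_add_iff 1).2
      (Real.summable_one_div_nat_pow.2 one_lt_two)).of_nonneg_of_le (fun i => by positivity)
      (fun i => ?_)
    push_cast
    gcongr
    nlinarith [(i.cast_nonneg : (0 : ℝ) ≤ i)]
  have htail := (tendsto_sum_Ico_of_summable (fun i => by positivity) hsum
    (fun m => m ^ 2)).const_mul B
  rw [mul_zero] at htail
  filter_upwards [tendsto_sqrt_sub_one.eventually (key.and (htail.eventually_le_const hc0)),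
    eventually_ge_atTop 5] with n hn hn5 z hz
  have h1 := (hn.1 z hz).1
  have h2 := hn.2
  have hr0 := norm_nonneg (φ z)
  have hr1 : ‖φ z‖ ≤ 1 := (mem_disc.1 (hφ.2 hz)).le
  have h3 := log_mul_pow_le_sum hr0 hr1 hn5
  set m := Nat.sqrt (n - 1)
  have hw := (weight_pos β hz).le
  have h4 : ∑ i ∈ Finset.Ico m (m ^ 2), 1 / ((i : ℝ) + 2) * ‖φ z‖ ^ (i + 2) ≤
      ∑ i ∈ Finset.Ico m (m ^ 2), 1 / ((i : ℝ) + 1) * ‖φ z‖ ^ (i + 1) := by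
    refine Finset.sum_le_sum fun i _ => ?_
    gcongr ?_ * ?_
    · gcongr
      norm_num
    · exact pow_le_pow_of_le_one hr0 hr1 (by lia)
  have h5 : weight β z * ‖deriv (deriv g) z‖ *
      ∑ i ∈ Finset.Ico m (m ^ 2), 1 / (((i : ℝ) + 1) * (i + 2)) * ‖φ z‖ ^ (i + 2) ≤ c := by
    refine le_trans (mul_le_mul (hBz z hz).2 (Finset.sum_le_sum fun i _ => ?_)
      (by positivity) hB.le) h2
    exact mul_le_of_le_one_right (by positivity) (pow_le_one₀ hr0 hr1)
  calc _ = weight β z * ‖deriv g z * deriv φ z‖ * (Real.log n * ‖φ z‖ ^ n) := by ring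
    _ ≤ weight β z * ‖deriv g z * deriv φ z‖ *
        (8 * ∑ i ∈ Finset.Ico m (m ^ 2), 1 / ((i : ℝ) + 1) * ‖φ z‖ ^ (i + 1)) :=
      mul_le_mul_of_nonneg_left (by linarith) (by positivity)
    _ ≤ 8 * 3 * c := by linarith

/-- With coefficients i+1 the harmonic block appears in the function itself and multiplies g''. The
derivative is a geometric block, at most r^m/(1-r), hence at most e⁴·k·r^k for some k ≥ m; the power
estimate for u at that k absorbs it. -/
theorem exists_lower_log_two (β : ℝ) :
    ∃ C : ℝ, 0 < C ∧ ∀ (φ g : ℂ → ℂ), IsAnalyticSelfMap φ → IsAnalyticOnDisc g →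
      ∀ T : Zygmund 2 →L[ℂ] Zygmund β, IsVolterraComp g φ T →
      ∀ c : ℝ, essNorm T < ENNReal.ofReal c → ∀ᶠ n : ℕ in atTop, ∀ z ∈ disc,
        Real.log n * (weight β z * (‖deriv (deriv g) z‖ * ‖φ z‖ ^ n)) ≤ C * c := by
  obtain ⟨A, hA, hAu⟩ := exists_lower_pow_of_two_le β (α := 2) le_rfl
  refine ⟨8 * (4 + Real.exp 4 * A), by positivity, fun φ g hφ hg T hT c hc => ?_⟩
  have hc0 : 0 < c := ENNReal.ofReal_pos.1 (pos_of_gt hc)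
  have key := hT.eventually_le_add two_pos hφ hg (S := fun m => Finset.Ico m (m ^ 2))
    (a := fun _ i => (i : ℝ) + 1) (fun _ _ _ => by positivity) (M := 4) (by norm_num)
    (fun n r hr hr1 => by
      have h1 : 0 < 1 - r := by linarith
      have h := sum_le_hasSum (Finset.Ico n (n ^ 2)) (fun i _ => by positivity)
        (hasSum_succ_mul_geometric hr hr1)
      rw [Real.rpow_two]
      calc (1 - r ^ 2) ^ 2 * ∑ i ∈ Finset.Ico n (n ^ 2), ((i : ℝ) + 1) * r ^ i
          ≤ (1 - r ^ 2) ^ 2 * (1 / (1 - r) ^ 2) := mul_le_mul_of_nonneg_left h (sq_nonneg _)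
        _ = (1 + r) ^ 2 := by
            field_simp
            ring
        _ ≤ 4 := by nlinarith)
    (fun r hr hr1 => tendsto_sum_Ico_of_summable (fun i => by positivity)
        (hasSum_succ_mul_geometric hr hr1).summable (fun m => m ^ 2)) hc
  obtain ⟨n₀, hn₀⟩ := eventually_atTop.1 (hAu φ g hφ hg T hT c hc)
  filter_upwards [tendsto_sqrt_sub_one.eventually (key.and (eventually_ge_atTop n₀)),
    eventually_ge_atTop 5] with n hn hn5 z hz
  have h1 := (hn.1 z hz).2
  have h2 := hn.2
  have hr0 := norm_nonneg (φ z)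
  have hr1 : ‖φ z‖ < 1 := mem_disc.1 (hφ.2 hz)
  have h3 := log_mul_pow_le_sum hr0 hr1.le hn5
  have hm2 : 2 ≤ Nat.sqrt (n - 1) := Nat.le_sqrt.2 (by lia)
  set m := Nat.sqrt (n - 1)
  have hw := (weight_pos β hz).le
  have e0 : ∑ i ∈ Finset.Ico m (m ^ 2),
      ((i : ℝ) + 1) / (((i : ℝ) + 1) * (i + 2)) * ‖φ z‖ ^ (i + 2) =
      ∑ i ∈ Finset.Ico m (m ^ 2), 1 / ((i : ℝ) + 2) * ‖φ z‖ ^ (i + 2) := by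
    refine Finset.sum_congr rfl fun i _ => ?_
    field_simp
  have h4 : ∑ i ∈ Finset.Ico m (m ^ 2), ((i : ℝ) + 1) / ((i : ℝ) + 1) * ‖φ z‖ ^ (i + 1) ≤
      ‖φ z‖ ^ m / (1 - ‖φ z‖) := by
    have h5 : ∑ i ∈ Finset.Ico m (m ^ 2), ((i : ℝ) + 1) / ((i : ℝ) + 1) * ‖φ z‖ ^ (i + 1) ≤
        ∑ i ∈ Finset.Ico m (m ^ 2), ‖φ z‖ ^ i := by
      refine Finset.sum_le_sum fun i _ => ?_
      rw [div_self (by positivity), one_mul]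
      exact pow_le_pow_of_le_one hr0 hr1.le (by lia)
    refine h5.trans ?_
    have h6 := sum_le_hasSum (Finset.range (m ^ 2 - m)) (fun i _ => pow_nonneg hr0 i)
      (hasSum_geometric_of_lt_one hr0 hr1)
    rw [Finset.sum_Ico_eq_sum_range]
    simp_rw [pow_add]
    rw [← Finset.mul_sum, div_eq_mul_inv]
    gcongr
  -- The index k depends on z. This is harmless because the power estimate holds for all z at once
  -- as soon as k ≥ n₀.
  obtain ⟨k, hk, hkr⟩ := exists_pow_div_le hr0 hr1 hm2
  have h7 : weight β z * ‖deriv g z * deriv φ z‖ *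
      ∑ i ∈ Finset.Ico m (m ^ 2), ((i : ℝ) + 1) / ((i : ℝ) + 1) * ‖φ z‖ ^ (i + 1)
      ≤ Real.exp 4 * A * c := by
    have h8 := (hn₀ k (h2.trans hk) z hz).1
    rw [show (2 : ℝ) - 1 = 1 by norm_num, Real.rpow_one] at h8
    calc _ ≤ weight β z * ‖deriv g z * deriv φ z‖ *
          (Real.exp 4 * ((k + 1) * ‖φ z‖ ^ k)) := by
          gcongr
          refine (h4.trans hkr).trans ?_
          gcongr
          linarith
      _ = Real.exp 4 * (((k : ℝ) + 1) *
          (weight β z * (‖deriv g z * deriv φ z‖ * ‖φ z‖ ^ k))) := by ring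
      _ ≤ Real.exp 4 * (A * c) := by gcongr
      _ = _ := by ring
  rw [e0] at h1
  calc _ = weight β z * ‖deriv (deriv g) z‖ * (Real.log n * ‖φ z‖ ^ n) := by ring
    _ ≤ weight β z * ‖deriv (deriv g) z‖ *
        (8 * ∑ i ∈ Finset.Ico m (m ^ 2), 1 / ((i : ℝ) + 2) * ‖φ z‖ ^ (i + 2)) := by gcongr
    _ ≤ 8 * (4 + Real.exp 4 * A) * c := by linarith

/-! ### Finite rank approximation of the identity -/

section Approx

variable {α : ℝ}

lemma Zygmund.add_props (f g : Zygmund α) {z : ℂ} (hz : z ∈ disc) :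
    (f + g) z = f z + g z ∧ deriv (f + g : Zygmund α) z = deriv f z + deriv g z ∧
      deriv (deriv (f + g : Zygmund α)) z = deriv (deriv f) z + deriv (deriv g) z :=
  ⟨rfl, deriv_add_of_disc f.mem.1 g.mem.1 hz, deriv2_add f.mem.1 g.mem.1 hz⟩

lemma Zygmund.smul_props (c : ℂ) (f : Zygmund α) (z : ℂ) :
    (c • f) z = c * f z ∧ deriv (c • f : Zygmund α) z = c * deriv f z ∧
      deriv (deriv (c • f : Zygmund α)) z = c * deriv (deriv f) z := by
  refine ⟨rfl, ?_, deriv2_smul c f z⟩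
  change deriv (c • f.toFun) z = _
  simp [deriv_const_smul_field]

lemma Zygmund.sub_props (f g : Zygmund α) {z : ℂ} (hz : z ∈ disc) :
    (f - g) z = f z - g z ∧ deriv (f - g : Zygmund α) z = deriv f z - deriv g z ∧
      deriv (deriv (f - g : Zygmund α)) z = deriv (deriv f) z - deriv (deriv g) z := by
  have e : f - g = f + (-1 : ℂ) • g := by simp [sub_eq_add_neg]
  have h1 := Zygmund.add_props f ((-1 : ℂ) • g) hz
  have h2 := Zygmund.smul_props (-1 : ℂ) g z
  rw [e, h1.1, h1.2.1, h1.2.2, h2.1, h2.2.1, h2.2.2]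
  refine ⟨?_, ?_, ?_⟩ <;> ring

lemma weight_anti (hα : 0 < α) {z w : ℂ} (hw : w ∈ disc) (h : ‖z‖ ≤ ‖w‖) :
    weight α w ≤ weight α z := by
  have h1 := mem_disc.1 hw
  have h2 := norm_nonneg z
  have h3 := norm_nonneg w
  exact Real.rpow_le_rpow (by nlinarith) (by nlinarith) hα.le

lemma Zygmund.norm_deriv2_le (hα : 0 < α) (f : Zygmund α) {s : ℝ} (hs : s < 1) {z : ℂ}
    (hz : ‖z‖ ≤ s) : ‖deriv (deriv f) z‖ ≤ ‖f‖ / (1 - s ^ 2) ^ α := by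
  have hs0 : 0 ≤ s := (norm_nonneg z).trans hz
  have hzd : z ∈ disc := mem_disc.2 (hz.trans_lt hs)
  have hsd : (s : ℂ) ∈ disc := by
    rw [mem_disc, Complex.norm_real, Real.norm_of_nonneg hs0]
    exact hs
  have h1 : weight α (s : ℂ) = (1 - s ^ 2) ^ α := by
    rw [weight, Complex.norm_real, Real.norm_of_nonneg hs0]
  have h2 := weight_anti hα (z := z) hsd (by rwa [Complex.norm_real, Real.norm_of_nonneg hs0])
  have h3 := weight_pos α hsd
  rw [← h1, le_div_iff₀ h3, mul_comm]
  exact (mul_le_mul_of_nonneg_right h2 (norm_nonneg _)).trans (f.weight_mul_le hzd)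

lemma Zygmund.norm_iteratedDeriv_le (hα : 0 < α) (f : Zygmund α) (n : ℕ) {s : ℝ} (hs0 : 0 < s)
    (hs : s < 1) :
    ‖iteratedDeriv (n + 2) f 0‖ ≤ n.factorial * (‖f‖ / (1 - s ^ 2) ^ α) / s ^ n := by
  rw [iteratedDeriv_succ', iteratedDeriv_succ']
  refine Complex.norm_iteratedDeriv_le_of_forall_mem_sphere_norm_le n hs0 ?_ fun z hz => ?_
  · exact (deriv_differentiableOn (deriv_differentiableOn f.mem.1)).diffContOnCl_ball
      (closedBall_subset_ball hs)
  · exact f.norm_deriv2_le hα hs (mem_sphere_zero_iff_norm.1 hz).le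

lemma Zygmund.contDiffAt (f : Zygmund α) (n : WithTop ℕ∞) : ContDiffAt ℂ n f 0 :=
  (f.mem.1.analyticAt (isOpen_ball.mem_nhds zero_mem_disc)).contDiffAt

/-- The value at the origin as a continuous functional. -/
def evalZero (α : ℝ) : Zygmund α →L[ℂ] ℂ :=
  LinearMap.mkContinuous
    { toFun := fun f => f 0
      map_add' := fun f g => (f.add_props g zero_mem_disc).1
      map_smul' := fun c f => (f.smul_props c 0).1 } 1
    fun f => by simpa using f.norm_apply_zero_le

/-- The derivative at the origin as a continuous functional. -/
def derivZero (α : ℝ) : Zygmund α →L[ℂ] ℂ :=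
  LinearMap.mkContinuous
    { toFun := fun f => deriv f 0
      map_add' := fun f g => (f.add_props g zero_mem_disc).2.1
      map_smul' := fun c f => (f.smul_props c 0).2.1 } 1
    fun f => by simpa using f.norm_deriv_zero_le

/-- The derivative of order `n + 2` at the origin as a continuous functional. -/
def iteratedDerivZero (hα : 0 < α) (n : ℕ) : Zygmund α →L[ℂ] ℂ :=
  LinearMap.mkContinuous
    { toFun := fun f => iteratedDeriv (n + 2) f 0
      map_add' := fun f g => iteratedDeriv_add (f.contDiffAt _) (g.contDiffAt _)
      map_smul' := fun c f => iteratedDeriv_const_smul_field c f.toFun }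
    (n.factorial / (1 - (1 / 2 : ℝ) ^ 2) ^ α / (1 / 2) ^ n)
    fun f => (f.norm_iteratedDeriv_le hα n (s := 1 / 2) (by norm_num) (by norm_num)).trans_eq (by ring)

lemma isCompactOperator_smulRight {X Y : Type*} [NormedAddCommGroup X] [NormedSpace ℂ X]
    [NormedAddCommGroup Y] [NormedSpace ℂ Y] (l : X →L[ℂ] ℂ) (y : Y) :
    IsCompactOperator (l.smulRight y) := by
  have h : IsCompactOperator (l : X → ℂ) := isCompactOperator_of_locallyCompactSpace_dom l
  exact h.clm_comp ((ContinuousLinearMap.id ℂ ℂ).smulRight y)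

lemma isCompactOperator_sum {X Y : Type*} [NormedAddCommGroup X] [NormedSpace ℂ X]
    [NormedAddCommGroup Y] [NormedSpace ℂ Y] (S : Finset ℕ) {L : ℕ → X →L[ℂ] Y}
    (h : ∀ i, IsCompactOperator (L i)) : IsCompactOperator (∑ i ∈ S, L i : X →L[ℂ] Y) := by
  induction S using Finset.induction_on with
  | empty => simpa using isCompactOperator_zero
  | insert a s ha ih =>
    rw [Finset.sum_insert ha]
    exact (h a).add ih

/-- The finite rank operators that replace `f''` by a Taylor polynomial of `f''(r z)`. -/
lemma exists_taylor_operator (hα : 0 < α) (r : ℝ) (N : ℕ) :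
    ∃ L : Zygmund α →L[ℂ] Zygmund α, IsCompactOperator L ∧ ∀ f : Zygmund α,
      L f 0 = f 0 ∧ deriv (L f) 0 = deriv f 0 ∧ ∀ z ∈ disc, deriv (deriv (L f)) z =
        ∑ n ∈ Finset.range N,
          ((n.factorial : ℂ)⁻¹ * (r * z) ^ n) * iteratedDeriv n (deriv (deriv f)) 0 := by
  obtain ⟨e₀, he₀⟩ := Zygmund.exists_eqOn (α := α) (f := fun _ => 1) (f₁ := fun _ => 0)
    (f₂ := fun _ => 0) (M := 0) (fun z _ => hasDerivAt_const z _) (fun z _ => hasDerivAt_const z _)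
    (fun z _ => by simp)
  obtain ⟨e₁, he₁⟩ := Zygmund.exists_eqOn (α := α) (f := fun z => z) (f₁ := fun _ => 1)
    (f₂ := fun _ => 0) (M := 0) (fun z _ => hasDerivAt_id' z) (fun z _ => hasDerivAt_const z _)
    (fun z _ => by simp)
  have hE : ∀ n : ℕ, ∃ E : Zygmund α, ∀ z ∈ disc, E z = testFun {n} 1 z ∧
      deriv E z = testFunDeriv {n} 1 z ∧ deriv (deriv E) z = z ^ n := by
    intro n
    refine Zygmund.exists_eqOn (M := 1) (fun z _ => hasDerivAt_testFun _ _ z)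
      (fun z _ => by simpa using hasDerivAt_testFunDeriv {n} 1 z) (fun z hz => ?_)
    rw [norm_pow]
    exact mul_le_one₀ (weight_le_one hα hz) (by positivity)
      (pow_le_one₀ (norm_nonneg z) (mem_disc.1 hz).le)
  choose E hE using hE
  refine ⟨(evalZero α).smulRight e₀ + (derivZero α).smulRight e₁ + ∑ n ∈ Finset.range N,
    (iteratedDerivZero hα n).smulRight (((n.factorial : ℂ)⁻¹ * r ^ n) • E n), ?_, fun f => ?_⟩
  · exact ((isCompactOperator_smulRight _ _).add (isCompactOperator_smulRight _ _)).add
      (isCompactOperator_sum _ fun n => isCompactOperator_smulRight _ _)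
  · set F : ℕ → Zygmund α := fun n =>
      iteratedDeriv (n + 2) f 0 • (((n.factorial : ℂ)⁻¹ * r ^ n) • E n) with hFdef
    have hL : ((evalZero α).smulRight e₀ + (derivZero α).smulRight e₁ + ∑ n ∈ Finset.range N,
        (iteratedDerivZero hα n).smulRight (((n.factorial : ℂ)⁻¹ * r ^ n) • E n)) f =
        f 0 • e₀ + deriv f 0 • e₁ + ∑ n ∈ Finset.range N, F n := by
      rw [add_apply, add_apply, sum_apply]
      rfl
    rw [hL]
    have hF : ∀ n, ∀ z ∈ disc, F n z =
        iteratedDeriv (n + 2) f 0 * (((n.factorial : ℂ)⁻¹ * r ^ n) * testFun {n} 1 z) ∧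
        deriv (F n) z =
        iteratedDeriv (n + 2) f 0 * (((n.factorial : ℂ)⁻¹ * r ^ n) * testFunDeriv {n} 1 z) ∧
        deriv (deriv (F n)) z =
        iteratedDeriv (n + 2) f 0 * (((n.factorial : ℂ)⁻¹ * r ^ n) * z ^ n) := by
      intro n z hz
      have h1 := Zygmund.smul_props (iteratedDeriv (n + 2) f 0)
        (((n.factorial : ℂ)⁻¹ * r ^ n) • E n) z
      have h2 := Zygmund.smul_props ((n.factorial : ℂ)⁻¹ * r ^ n) (E n) z
      rw [h2.1, h2.2.1, h2.2.2, (hE n z hz).1, (hE n z hz).2.1, (hE n z hz).2.2] at h1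
      exact h1
    have h : ∀ z ∈ disc, _ := fun z hz => And.intro
      (Zygmund.add_props (f 0 • e₀ + deriv f 0 • e₁) (∑ n ∈ Finset.range N, F n) hz) (And.intro
      (Zygmund.add_props (f 0 • e₀) (deriv f 0 • e₁) hz) (And.intro
      (Zygmund.smul_props (f 0) e₀ z) (And.intro (Zygmund.smul_props (deriv f 0) e₁ z)
      (Zygmund.sum_props (Finset.range N) F hz))))
    refine ⟨?_, ?_, fun z hz => ?_⟩
    · obtain ⟨a, b, c, d, e⟩ := h 0 zero_mem_disc
      rw [a.1, b.1, c.1, d.1, e.1, (he₀ 0 zero_mem_disc).1, (he₁ 0 zero_mem_disc).1,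
        Finset.sum_eq_zero fun n _ => by rw [(hF n 0 zero_mem_disc).1]; simp [testFun]]
      ring
    · obtain ⟨a, b, c, d, e⟩ := h 0 zero_mem_disc
      rw [a.2.1, b.2.1, c.2.1, d.2.1, e.2.1, (he₀ 0 zero_mem_disc).2.1,
        (he₁ 0 zero_mem_disc).2.1, Finset.sum_eq_zero fun n _ => by
          rw [(hF n 0 zero_mem_disc).2.1]; simp [testFunDeriv]]
      ring
    · obtain ⟨a, b, c, d, e⟩ := h z hz
      rw [a.2.2, b.2.2, c.2.2, d.2.2, e.2.2, (he₀ z hz).2.2, (he₁ z hz).2.2, mul_zero, mul_zero,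
        zero_add, zero_add]
      refine Finset.sum_congr rfl fun n _ => ?_
      rw [(hF n z hz).2.2, iteratedDeriv_succ', iteratedDeriv_succ']
      ring

/-- Cauchy's estimates on the circle of radius s > r bound the Taylor terms of f'' at rz by a
geometric sequence of ratio r/s, uniformly in z. -/
lemma Zygmund.norm_taylor_sub_le (hα : 0 < α) (f : Zygmund α) {r s : ℝ} (hr : 0 ≤ r) (hrs : r < s)
    (hs : s < 1) (N : ℕ) {z : ℂ} (hz : z ∈ disc) :
    ‖∑ n ∈ Finset.range N, ((n.factorial : ℂ)⁻¹ * (r * z) ^ n) *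
      iteratedDeriv n (deriv (deriv f)) 0 - deriv (deriv f) (r * z)‖ ≤
      ‖f‖ / (1 - s ^ 2) ^ α * (r / s) ^ N / (1 - r / s) := by
  have hs0 : 0 < s := hr.trans_lt hrs
  have hz1 := mem_disc.1 hz
  have hrz : ‖(r : ℂ) * z‖ ≤ r := by
    rw [norm_mul, Complex.norm_real, Real.norm_of_nonneg hr]
    exact mul_le_of_le_one_right hr hz1.le
  have hmem : (r : ℂ) * z ∈ disc := mem_disc.2 (hrz.trans_lt (hrs.trans hs))
  have hsum := Complex.hasSum_taylorSeries_on_ball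
    (deriv_differentiableOn (deriv_differentiableOn f.mem.1)) hmem
  simp only [sub_zero, smul_eq_mul, ← mul_assoc] at hsum
  refine norm_sub_le_of_geometric_bound_of_hasSum ((div_lt_one hs0).2 hrs) (fun n => ?_) hsum N
  have h1 := f.norm_iteratedDeriv_le hα n hs0 hs
  rw [iteratedDeriv_succ', iteratedDeriv_succ'] at h1
  have hf : (n.factorial : ℝ) ≠ 0 := by positivity
  calc _ = (n.factorial : ℝ)⁻¹ * ‖(r : ℂ) * z‖ ^ n * ‖iteratedDeriv n (deriv (deriv f)) 0‖ := by
        rw [norm_mul, norm_mul, norm_inv, Complex.norm_natCast, norm_pow]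
    _ ≤ (n.factorial : ℝ)⁻¹ * r ^ n * (n.factorial * (‖f‖ / (1 - s ^ 2) ^ α) / s ^ n) := by
        gcongr
    _ = ‖f‖ / (1 - s ^ 2) ^ α * (r / s) ^ n := by
        rw [div_pow]
        field_simp

/-- Cauchy's estimate on discs of radius (1-ρ)/2, which stay inside |v| ≤ (1+ρ)/2, bounds f''' on
|w| ≤ ρ; the mean value inequality between rz and z does the rest. -/
lemma Zygmund.exists_dilation_bound (hα : 0 < α) {ρ : ℝ} (hρ0 : 0 ≤ ρ) (hρ : ρ < 1) :
    ∃ C : ℝ, 0 < C ∧ ∀ f : Zygmund α, ∀ r : ℝ, 0 ≤ r → r ≤ 1 → ∀ z : ℂ, ‖z‖ ≤ ρ →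
      ‖deriv (deriv f) z - deriv (deriv f) (r * z)‖ ≤ C * (1 - r) * ‖f‖ := by
  have hs : (1 + ρ) / 2 < 1 := by linarith
  have hw : 0 < (1 - ((1 + ρ) / 2) ^ 2) ^ α := Real.rpow_pos_of_pos (by nlinarith) _
  refine ⟨1 / (1 - ((1 + ρ) / 2) ^ 2) ^ α / ((1 - ρ) / 2), div_pos (by positivity) (by linarith),
    fun f r hr hr1 z hz => ?_⟩
  have hd := deriv_differentiableOn (deriv_differentiableOn f.mem.1)
  have hsub : closedBall (0 : ℂ) ρ ⊆ disc := closedBall_subset_ball hρ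
  have hb : ∀ w ∈ closedBall (0 : ℂ) ρ, ‖deriv (deriv (deriv f)) w‖ ≤
      ‖f‖ / (1 - ((1 + ρ) / 2) ^ 2) ^ α / ((1 - ρ) / 2) := by
    intro w hw
    have hw' : ‖w‖ ≤ ρ := by simpa using hw
    have hb : ∀ v ∈ closedBall w ((1 - ρ) / 2), ‖v‖ ≤ (1 + ρ) / 2 := by
      intro v hv
      have h1 : ‖v - w‖ ≤ (1 - ρ) / 2 := by simpa [dist_eq_norm] using hv
      have h2 := norm_sub_norm_le v w
      linarith
    refine Complex.norm_deriv_le_of_forall_mem_sphere_norm_le (by linarith) ?_ fun v hv =>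
      f.norm_deriv2_le hα hs (hb v (sphere_subset_closedBall hv))
    exact hd.diffContOnCl_ball fun v hv => mem_disc.2 ((hb v hv).trans_lt hs)
  have hz' : z ∈ closedBall (0 : ℂ) ρ := by simpa using hz
  have hrz' : (r : ℂ) * z ∈ closedBall (0 : ℂ) ρ := by
    rw [mem_closedBall_zero_iff, norm_mul, Complex.norm_real, Real.norm_of_nonneg hr]
    exact (mul_le_of_le_one_left (norm_nonneg z) hr1).trans hz
  have h := (convex_closedBall (0 : ℂ) ρ).norm_image_sub_le_of_norm_deriv_le
    (fun w hw => differentiableAt_of_disc hd (hsub hw)) hb hrz' hz'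
  refine h.trans ?_
  have h1 : ‖z - r * z‖ ≤ 1 - r := by
    have e : z - r * z = ((1 - r : ℝ) : ℂ) * z := by
      push_cast
      ring
    rw [e, norm_mul, Complex.norm_real, Real.norm_of_nonneg (by linarith)]
    exact mul_le_of_le_one_right (by linarith) (hz.trans hρ.le)
  calc _ ≤ ‖f‖ / (1 - ((1 + ρ) / 2) ^ 2) ^ α / ((1 - ρ) / 2) * (1 - r) := by
        refine mul_le_mul_of_nonneg_left h1 (div_nonneg (by positivity) (by linarith))
    _ = _ := by ring

/-- First r is taken close to 1, so that the dilation is harmless on |z| ≤ ρ; then the Taylor degree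
is taken large for this r. The 3 counts f''(z), f''(rz) and the Taylor remainder, each of weighted
size at most ‖f‖; for the dilation this holds because the weight decreases in |z|. -/
lemma exists_compact_approx (hα : 0 < α) {ρ ε : ℝ} (hρ0 : 0 ≤ ρ) (hρ : ρ < 1) (hε : 0 < ε) :
    ∃ L : Zygmund α →L[ℂ] Zygmund α, IsCompactOperator L ∧ ∀ f : Zygmund α,
      (f - L f) 0 = 0 ∧ deriv (f - L f : Zygmund α) 0 = 0 ∧ ‖f - L f‖ ≤ 3 * ‖f‖ ∧
      ∀ z ∈ disc, ‖z‖ ≤ ρ → ‖deriv (deriv (f - L f : Zygmund α)) z‖ ≤ ε * ‖f‖ := by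
  obtain ⟨C, hC, hCf⟩ := Zygmund.exists_dilation_bound hα hρ0 hρ
  obtain ⟨r, hr0, hr1, hrC⟩ : ∃ r : ℝ, 0 ≤ r ∧ r < 1 ∧ C * (1 - r) ≤ ε / 2 := by
    refine ⟨max 0 (1 - ε / (2 * C)), le_max_left _ _, max_lt one_pos (by
      have : 0 < ε / (2 * C) := by positivity
      linarith), ?_⟩
    calc C * (1 - max 0 (1 - ε / (2 * C))) ≤ C * (ε / (2 * C)) := by
          gcongr
          linarith [le_max_right 0 (1 - ε / (2 * C))]
      _ = ε / 2 := by field_simp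
  have hrs : r < (1 + r) / 2 := by linarith
  have hs1 : (1 + r) / 2 < 1 := by linarith
  have hs0 : 0 < (1 + r) / 2 := by linarith
  obtain ⟨N, hN⟩ : ∃ N : ℕ, 1 / (1 - ((1 + r) / 2) ^ 2) ^ α * (r / ((1 + r) / 2)) ^ N /
      (1 - r / ((1 + r) / 2)) ≤ min (ε / 2) 1 := by
    have h := ((tendsto_pow_atTop_nhds_zero_of_lt_one (r := r / ((1 + r) / 2)) (by positivity)
      ((div_lt_one hs0).2 hrs)).const_mul (1 / (1 - ((1 + r) / 2) ^ 2) ^ α)).div_const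
      (1 - r / ((1 + r) / 2))
    rw [mul_zero, zero_div] at h
    exact (h.eventually_le_const (lt_min (half_pos hε) one_pos)).exists
  obtain ⟨L, hL, hLf⟩ := exists_taylor_operator hα r N
  refine ⟨L, hL, fun f => ?_⟩
  obtain ⟨h0, h1, h2⟩ := hLf f
  have s0 := Zygmund.sub_props f (L f) zero_mem_disc
  have hv : (f - L f) 0 = 0 := by rw [s0.1, h0, sub_self]
  have hd : deriv (f - L f : Zygmund α) 0 = 0 := by rw [s0.2.1, h1, sub_self]
  have htail : ∀ z ∈ disc, ‖deriv (deriv (L f)) z - deriv (deriv f) (r * z)‖ ≤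
      min (ε / 2) 1 * ‖f‖ := by
    intro z hz
    rw [h2 z hz]
    refine (f.norm_taylor_sub_le hα hr0 hrs hs1 N hz).trans ?_
    refine le_trans (le_of_eq ?_) (mul_le_mul_of_nonneg_right hN (norm_nonneg f))
    ring
  refine ⟨hv, hd, ?_, fun z hz hzρ => ?_⟩
  · have h := (f - L f).norm_le (M := 3 * ‖f‖) fun z hz => by
      rw [(Zygmund.sub_props f (L f) hz).2.2]
      have hrz : ‖(r : ℂ) * z‖ ≤ ‖z‖ := by
        rw [norm_mul, Complex.norm_real, Real.norm_of_nonneg hr0]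
        exact mul_le_of_le_one_left (norm_nonneg z) hr1.le
      have hrzd : (r : ℂ) * z ∈ disc := mem_disc.2 (hrz.trans_lt (mem_disc.1 hz))
      have b1 := f.weight_mul_le hz
      have b2 : weight α z * ‖deriv (deriv f) (r * z)‖ ≤ ‖f‖ :=
        (mul_le_mul_of_nonneg_right (weight_anti hα hz hrz) (norm_nonneg _)).trans
          (f.weight_mul_le hrzd)
      have b3 : weight α z * ‖deriv (deriv (L f)) z - deriv (deriv f) (r * z)‖ ≤ 1 * ‖f‖ := by
        refine (mul_le_of_le_one_left (norm_nonneg _) (weight_le_one hα hz)).trans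
          ((htail z hz).trans ?_)
        gcongr
        exact min_le_right _ _
      have t : ‖deriv (deriv f) z - deriv (deriv (L f)) z‖ ≤ ‖deriv (deriv f) z‖ +
          (‖deriv (deriv f) (r * z)‖ + ‖deriv (deriv (L f)) z - deriv (deriv f) (r * z)‖) := by
        have t1 := norm_sub_le (deriv (deriv f) z) (deriv (deriv (L f)) z)
        have t2 := norm_sub_norm_le (deriv (deriv (L f)) z) (deriv (deriv f) (r * z))
        linarith
      have := mul_le_mul_of_nonneg_left t (weight_pos α hz).le
      linarith
    simpa [hv, hd] using h
  · rw [(Zygmund.sub_props f (L f) hz).2.2]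
    have b1 := hCf f r hr0 hr1.le z hzρ
    have b2 : C * (1 - r) * ‖f‖ ≤ ε / 2 * ‖f‖ := by gcongr
    have b3 : min (ε / 2) 1 * ‖f‖ ≤ ε / 2 * ‖f‖ := by
      gcongr
      exact min_le_left _ _
    have b4 := htail z hz
    have t := norm_sub_le (deriv (deriv f) z - deriv (deriv f) (r * z))
      (deriv (deriv (L f)) z - deriv (deriv f) (r * z))
    rw [sub_sub_sub_cancel_right] at t
    linarith

end Approx

/-! ### Growth of small functions towards the boundary -/

section Growth

/-- Along the ray through z the derivative of t ↦ F(tζ) has norm at most B'(t), so from the circle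
|z| = ρ on, |F| grows no faster than B. -/
lemma norm_le_of_radial_bound {F F₁ : ℂ → ℂ} (hF : ∀ z ∈ disc, HasDerivAt F (F₁ z) z)
    {B B' : ℝ → ℝ} (hB : ∀ t, 0 ≤ t → t < 1 → HasDerivAt B (B' t) t) {ρ b : ℝ} (hρ : 0 ≤ ρ)
    (hF₁ : ∀ z ∈ disc, ρ ≤ ‖z‖ → ‖F₁ z‖ ≤ B' ‖z‖) (hb : ∀ z ∈ disc, ‖z‖ = ρ → ‖F z‖ ≤ b)
    {z : ℂ} (hz : z ∈ disc) (hρz : ρ ≤ ‖z‖) : ‖F z‖ ≤ b + (B ‖z‖ - B ρ) := by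
  have hz1 := mem_disc.1 hz
  obtain ⟨ζ, hζ, hζz⟩ : ∃ ζ : ℂ, ‖ζ‖ = 1 ∧ (‖z‖ : ℂ) * ζ = z := by
    obtain ⟨θ, hθ, h⟩ := exists_rotation z
    have hθ0 : θ ≠ 0 := by
      rintro rfl
      simp at hθ
    refine ⟨θ⁻¹, by rw [norm_inv, hθ, inv_one], ?_⟩
    rw [← h]
    field_simp
  have hn : ∀ t : ℝ, 0 ≤ t → ‖(t : ℂ) * ζ‖ = t := fun t ht => by
    rw [norm_mul, hζ, mul_one, Complex.norm_real, Real.norm_of_nonneg ht]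
  have hmem : ∀ t : ℝ, 0 ≤ t → t ≤ ‖z‖ → (t : ℂ) * ζ ∈ disc := fun t ht htz =>
    mem_disc.2 (by rw [hn t ht]; linarith)
  have hd : ∀ t : ℝ, 0 ≤ t → t ≤ ‖z‖ →
      HasDerivAt (fun t : ℝ => F (t * ζ)) (F₁ (t * ζ) * ζ) t := by
    intro t ht htz
    have h2 : HasDerivAt (fun t : ℝ => (t : ℂ) * ζ) ζ t := by
      simpa using (Complex.ofRealCLM.hasDerivAt (x := t)).mul_const ζ
    exact (hF _ (hmem t ht htz)).comp t h2
  have hBd : ∀ t ∈ Set.Icc ρ ‖z‖, HasDerivAt (fun t => b + (B t - B ρ)) (B' t) t := fun t ht =>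
    ((hB t (hρ.trans ht.1) (ht.2.trans_lt hz1)).sub_const _).const_add _
  have key := image_norm_le_of_norm_deriv_right_le_deriv_boundary' (a := ρ) (b := ‖z‖)
    (f := fun t : ℝ => F (t * ζ)) (f' := fun t : ℝ => F₁ (t * ζ) * ζ)
    (fun t ht => (hd t (hρ.trans ht.1) ht.2).continuousAt.continuousWithinAt)
    (fun t ht => (hd t (hρ.trans ht.1) ht.2.le).hasDerivWithinAt)
    (B := fun t => b + (B t - B ρ)) (B' := B')
    (by
      rw [sub_self, add_zero]
      exact hb _ (hmem ρ hρ hρz) (hn ρ hρ))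
    (fun t ht => (hBd t ht).continuousAt.continuousWithinAt)
    (fun t ht => (hBd t ⟨ht.1, ht.2.le⟩).hasDerivWithinAt)
    (fun t ht => by
      have h := hF₁ _ (hmem t (hρ.trans ht.1) ht.2.le) (by rw [hn t (hρ.trans ht.1)]; exact ht.1)
      rw [hn t (hρ.trans ht.1)] at h
      rwa [norm_mul, hζ, mul_one]) (Set.right_mem_Icc.2 hρz)
  simpa only [hζz] using key

lemma norm_le_of_deriv_bound {F F₁ : ℂ → ℂ} (hF : ∀ z ∈ disc, HasDerivAt F (F₁ z) z)
    (hF0 : F 0 = 0) {ρ b : ℝ} (hρ0 : 0 ≤ ρ) (hρ : ρ < 1) (hb : ∀ z ∈ disc, ‖z‖ ≤ ρ → ‖F₁ z‖ ≤ b)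
    {z : ℂ} (hz : ‖z‖ ≤ ρ) : ‖F z‖ ≤ b := by
  have hsub : closedBall (0 : ℂ) ρ ⊆ disc := closedBall_subset_ball hρ
  have h := (convex_closedBall (0 : ℂ) ρ).norm_image_sub_le_of_norm_hasDerivWithin_le
    (fun w hw => (hF w (hsub hw)).hasDerivWithinAt)
    (fun w hw => hb w (hsub hw) (by simpa using hw)) (mem_closedBall_self hρ0)
    (by simpa using hz : z ∈ closedBall (0 : ℂ) ρ)
  rw [hF0, sub_zero, sub_zero] at h
  have hb0 : 0 ≤ b := (norm_nonneg _).trans (hb 0 zero_mem_disc (by simpa using hρ0))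
  exact h.trans (mul_le_of_le_one_right hb0 (hz.trans hρ.le))

variable {α : ℝ}

/-- The functions `h` that vanish to second order at the origin, have norm at most `3 M` and
second derivative at most `ε M` on the disc of radius `ρ`. -/
structure IsSmall (h : Zygmund α) (M ρ ε : ℝ) : Prop where
  apply_zero : h 0 = 0
  deriv_zero : deriv h 0 = 0
  norm_le : ‖h‖ ≤ 3 * M
  deriv2_le : ∀ z ∈ disc, ‖z‖ ≤ ρ → ‖deriv (deriv h) z‖ ≤ ε * M

variable {h : Zygmund α} {M ρ ε : ℝ}

lemma IsSmall.mono (hs : IsSmall h M ρ ε) (hM : 0 ≤ M) {ε' : ℝ} (hε : ε ≤ ε') :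
    IsSmall h M ρ ε' :=
  ⟨hs.1, hs.2, hs.3, fun z hz hzρ =>
    (hs.4 z hz hzρ).trans (mul_le_mul_of_nonneg_right hε hM)⟩

lemma IsSmall.deriv_le (hs : IsSmall h M ρ ε) (hρ0 : 0 ≤ ρ) (hρ : ρ < 1) {z : ℂ}
    (hz : ‖z‖ ≤ ρ) : ‖deriv h z‖ ≤ ε * M :=
  norm_le_of_deriv_bound (fun _ hw => h.hasDerivAt_deriv hw) hs.deriv_zero hρ0 hρ hs.deriv2_le hz

lemma IsSmall.apply_le (hs : IsSmall h M ρ ε) (hρ0 : 0 ≤ ρ) (hρ : ρ < 1) {z : ℂ}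
    (hz : ‖z‖ ≤ ρ) : ‖h z‖ ≤ ε * M :=
  norm_le_of_deriv_bound (fun _ hw => h.hasDerivAt hw) hs.apply_zero hρ0 hρ
    (fun _ _ hw => hs.deriv_le hρ0 hρ hw) hz

lemma IsSmall.deriv2_growth (hs : IsSmall h M ρ ε) (hα : 0 < α) {z : ℂ}
    (hz : z ∈ disc) : ‖deriv (deriv h) z‖ ≤ 3 * M * (1 - ‖z‖) ^ (-α) := by
  have h1 := mem_disc.1 hz
  have h0 := norm_nonneg z
  have h2 := (h.weight_mul_le hz).trans hs.norm_le
  have hp : 0 < 1 - ‖z‖ := by linarith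
  have h3 : (1 - ‖z‖) ^ α ≤ weight α z := Real.rpow_le_rpow hp.le (by nlinarith) hα.le
  have h4 : 0 < (1 - ‖z‖) ^ α := Real.rpow_pos_of_pos hp _
  rw [Real.rpow_neg hp.le, ← div_eq_mul_inv, le_div_iff₀ h4, mul_comm]
  exact (mul_le_mul_of_nonneg_right h3 (norm_nonneg _)).trans h2

lemma IsSmall.deriv_growth (hs : IsSmall h M ρ ε) (hα : 0 < α) (hM : 0 ≤ M) (hρ0 : 0 ≤ ρ)
    (hρ : ρ < 1) {B B' : ℝ → ℝ} (hB : ∀ t, 0 ≤ t → t < 1 → HasDerivAt B (B' t) t)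
    (hB' : ∀ t, 0 ≤ t → t < 1 → (1 - t) ^ (-α) ≤ B' t) {z : ℂ} (hz : z ∈ disc) (hρz : ρ ≤ ‖z‖) :
    ‖deriv h z‖ ≤ (ε + 3 * (B ‖z‖ - B ρ)) * M := by
  refine (norm_le_of_radial_bound (fun w hw => h.hasDerivAt_deriv hw)
    (B := fun t => 3 * M * B t) (B' := fun t => 3 * M * B' t)
    (fun t ht ht1 => (hB t ht ht1).const_mul _) hρ0 (fun w hw _ => ?_)
    (fun w _ hwρ => hs.deriv_le hρ0 hρ hwρ.le) hz hρz).trans_eq (by ring)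
  exact (hs.deriv2_growth hα hw).trans
    (mul_le_mul_of_nonneg_left (hB' _ (norm_nonneg w) (mem_disc.1 hw)) (by positivity))

/-- One ε comes from the circle |z| = ρ, the other from integrating the constant in the derivative
bound over an interval of length below 1. The term -3B(ρ) of that bound is dropped, which is where 0
≤ B(ρ) enters. -/
lemma IsSmall.apply_growth (hs : IsSmall h M ρ ε) (hα : 0 < α) (hM : 0 ≤ M) (hε : 0 ≤ ε)
    (hρ0 : 0 ≤ ρ) (hρ : ρ < 1) {E B B' : ℝ → ℝ}
    (hB : ∀ t, 0 ≤ t → t < 1 → HasDerivAt B (B' t) t)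
    (hB' : ∀ t, 0 ≤ t → t < 1 → (1 - t) ^ (-α) ≤ B' t)
    (hE : ∀ t, 0 ≤ t → t < 1 → HasDerivAt E (B t) t) (hBρ : 0 ≤ B ρ)
    {z : ℂ} (hz : z ∈ disc) (hρz : ρ ≤ ‖z‖) :
    ‖h z‖ ≤ (2 * ε + 3 * (E ‖z‖ - E ρ)) * M := by
  have h1 := norm_le_of_radial_bound (fun w hw => h.hasDerivAt hw) (b := ε * M)
    (B := fun t => M * (ε * t + 3 * E t)) (B' := fun t => M * (ε * 1 + 3 * B t))
    (fun t ht ht1 => (((hasDerivAt_id' t).const_mul ε).add ((hE t ht ht1).const_mul 3)).const_mul M)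
    hρ0 (fun w hw hwρ => ?_) (fun w _ hwρ => hs.apply_le hρ0 hρ hwρ.le) hz hρz
  · refine h1.trans ?_
    have : M * ε * (‖z‖ - ρ) ≤ M * ε := by
      refine mul_le_of_le_one_right (by positivity) ?_
      linarith [mem_disc.1 hz]
    nlinarith
  · refine (hs.deriv_growth hα hM hρ0 hρ hB hB' hw hwρ).trans ?_
    nlinarith

lemma hasDerivAt_rpow_one_sub {s t : ℝ} (ht : t < 1) :
    HasDerivAt (fun t : ℝ => (1 - t) ^ s) (-(s * (1 - t) ^ (s - 1))) t := by
  have h := ((hasDerivAt_id' t).const_sub 1).rpow_const (p := s) (Or.inl (by linarith))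
  exact h.congr_deriv (by ring)

lemma hasDerivAt_rpow_primitive {α t : ℝ} (hα : α ≠ 1) (ht : t < 1) :
    HasDerivAt (fun t : ℝ => (1 - t) ^ (1 - α) / (α - 1)) ((1 - t) ^ (-α)) t := by
  have h := (hasDerivAt_rpow_one_sub (s := 1 - α) ht).div_const (α - 1)
  have h0 : α - 1 ≠ 0 := sub_ne_zero.2 hα
  refine h.congr_deriv ?_
  rw [show 1 - α - 1 = -α by ring]
  field_simp
  ring

lemma hasDerivAt_neg_log {t : ℝ} (ht : t < 1) :
    HasDerivAt (fun t : ℝ => -Real.log (1 - t)) ((1 - t)⁻¹) t := by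
  have h := (((hasDerivAt_id' t).const_sub 1).log (by linarith)).neg
  refine h.congr_deriv ?_
  rw [neg_div, neg_neg, one_div]

lemma exists_rpow_one_sub_le {s : ℝ} (hs : 0 < s) {η : ℝ} (hη : 0 < η) :
    ∃ ρ₁ < 1, ∀ ρ, ρ₁ ≤ ρ → ρ < 1 → (1 - ρ) ^ s ≤ η := by
  have hpos : 0 < η ^ s⁻¹ := Real.rpow_pos_of_pos hη _
  refine ⟨1 - η ^ s⁻¹, by linarith, fun ρ h1 h2 => ?_⟩
  calc (1 - ρ) ^ s ≤ (η ^ s⁻¹) ^ s := Real.rpow_le_rpow (by linarith) (by linarith) hs.le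
    _ = η := Real.rpow_inv_rpow hη.le hs.ne'

/-- Small functions have a growth at the boundary controlled by `ω`, up to `η`; here `D h` is `h`
or `h'`. -/
def GrowthControl (α : ℝ) (D : Zygmund α → ℂ → ℂ) (ω : ℝ → ℝ) : Prop :=
  ∀ η > 0, ∃ ρ₁ < 1, ∀ ρ, ρ₁ ≤ ρ → 0 ≤ ρ → ρ < 1 → ∃ ε > 0, ∀ (h : Zygmund α) (M : ℝ), 0 ≤ M →
    IsSmall h M ρ ε → ∀ z ∈ disc,
      (‖z‖ ≤ ρ → ‖D h z‖ ≤ η * M) ∧ (ρ < ‖z‖ → ‖D h z‖ ≤ (ω ‖z‖ + η) * M)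

/-- Since (1-t)^(-α) is integrable up to 1, the growth of h' beyond ρ is at most a constant times
(1-ρ)^(1-α), which is small for ρ near 1. -/
lemma growthControl_deriv_of_lt_one (h0 : 0 < α) (h1 : α < 1) :
    GrowthControl α (fun h => deriv h) (fun _ => 0) := by
  intro η hη
  have hα1 : 0 < 1 - α := by linarith
  obtain ⟨ρ₁, hρ₁, hsm⟩ := exists_rpow_one_sub_le hα1 (η := η * (1 - α) / 6) (by positivity)
  refine ⟨ρ₁, hρ₁, fun ρ hρ₁ρ hρ0 hρ => ⟨η / 2, by positivity, fun h M hM hs z hz => ⟨fun hzρ => ?_,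
    fun hzρ => ?_⟩⟩⟩
  · exact (hs.mono hM (by linarith)).deriv_le hρ0 hρ hzρ
  · refine (hs.deriv_growth h0 hM hρ0 hρ (fun t _ ht => hasDerivAt_rpow_primitive h1.ne ht)
      (fun t _ _ => le_rfl) hz hzρ.le).trans (mul_le_mul_of_nonneg_right ?_ hM)
    have hp : 0 ≤ (1 - ‖z‖) ^ (1 - α) := Real.rpow_nonneg (by linarith [mem_disc.1 hz]) _
    have e : (1 - ‖z‖) ^ (1 - α) / (α - 1) - (1 - ρ) ^ (1 - α) / (α - 1) =
        ((1 - ρ) ^ (1 - α) - (1 - ‖z‖) ^ (1 - α)) / (1 - α) := by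
      rw [← neg_sub 1 α]
      field_simp
      ring
    have : ((1 - ρ) ^ (1 - α) - (1 - ‖z‖) ^ (1 - α)) / (1 - α) ≤ η / 6 := by
      rw [div_le_iff₀ hα1]
      linarith [hsm ρ hρ₁ρ hρ]
    rw [e]
    linarith

lemma growthControl_deriv_one :
    GrowthControl 1 (fun h => deriv h) (fun t => 3 * -Real.log (1 - t)) := by
  refine fun η hη => ⟨0, one_pos, fun ρ _ hρ0 hρ => ⟨η, hη, fun h M hM hs z hz =>
    ⟨fun hzρ => hs.deriv_le hρ0 hρ hzρ, fun hzρ => ?_⟩⟩⟩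
  refine (hs.deriv_growth one_pos hM hρ0 hρ (fun t _ ht => hasDerivAt_neg_log ht)
    (fun t _ ht => by rw [Real.rpow_neg_one]) hz hzρ.le).trans (mul_le_mul_of_nonneg_right ?_ hM)
  have := Real.log_nonpos (x := 1 - ρ) (by linarith) (by linarith)
  linarith

lemma growthControl_deriv_of_one_lt (h1 : 1 < α) :
    GrowthControl α (fun h => deriv h) (fun t => 3 / (α - 1) * (1 - t) ^ (1 - α)) := by
  refine fun η hη => ⟨0, one_pos, fun ρ _ hρ0 hρ => ⟨η, hη, fun h M hM hs z hz =>
    ⟨fun hzρ => hs.deriv_le hρ0 hρ hzρ, fun hzρ => ?_⟩⟩⟩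
  refine (hs.deriv_growth (by linarith) hM hρ0 hρ
    (fun t _ ht => hasDerivAt_rpow_primitive h1.ne' ht)
    (fun t _ _ => le_rfl) hz hzρ.le).trans (mul_le_mul_of_nonneg_right ?_ hM)
  have : 0 ≤ (1 - ρ) ^ (1 - α) / (α - 1) :=
    div_nonneg (Real.rpow_nonneg (by linarith) _) (by linarith)
  have e : 3 / (α - 1) * (1 - ‖z‖) ^ (1 - α) = 3 * ((1 - ‖z‖) ^ (1 - α) / (α - 1)) := by ring
  linarith

lemma growthControl_apply_of_lt_two (h0 : 0 < α) (h2 : α < 2) :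
    GrowthControl α (fun h => h) (fun _ => 0) := by
  intro η hη
  -- Enlarging the exponent to some a in (1,2) only weakens the bound on h''. It treats α < 1, α = 1
  -- and 1 < α < 2 together and avoids a logarithmic primitive.
  obtain ⟨a, ha1, ha2, haα⟩ : ∃ a : ℝ, 1 < a ∧ a < 2 ∧ α ≤ a :=
    ⟨max α (3 / 2), lt_max_of_lt_right (by norm_num), max_lt h2 (by norm_num), le_max_left _ _⟩
  have hp1 : 0 < a - 1 := by linarith
  have hp2 : 0 < 2 - a := by linarith
  obtain ⟨ρ₁, hρ₁, hsm⟩ := exists_rpow_one_sub_le hp2 (η := η * (2 - a) * (a - 1) / 6)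
    (by positivity)
  refine ⟨ρ₁, hρ₁, fun ρ hρ₁ρ hρ0 hρ => ⟨η / 4, by positivity, fun h M hM hs z hz => ⟨fun hzρ => ?_,
    fun hzρ => ?_⟩⟩⟩
  · exact (hs.mono hM (by linarith)).apply_le hρ0 hρ hzρ
  · have hE : ∀ t : ℝ, 0 ≤ t → t < 1 →
        HasDerivAt (fun t : ℝ => (1 - t) ^ (1 - (a - 1)) / ((a - 1) - 1) / (a - 1))
          ((1 - t) ^ (1 - a) / (a - 1)) t := fun t _ ht => by
      have := (hasDerivAt_rpow_primitive (α := a - 1) (by linarith) ht).div_const (a - 1)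
      rwa [neg_sub] at this
    refine (hs.apply_growth h0 hM (by positivity) hρ0 hρ
      (fun t _ ht => hasDerivAt_rpow_primitive ha1.ne' ht)
      (fun t ht ht1 => Real.rpow_le_rpow_of_exponent_ge (by linarith) (by linarith) (by linarith))
      hE (div_nonneg (Real.rpow_nonneg (by linarith) _) hp1.le) hz hzρ.le).trans
      (mul_le_mul_of_nonneg_right ?_ hM)
    rw [show 1 - (a - 1) = 2 - a by ring]
    have hp : 0 ≤ (1 - ‖z‖) ^ (2 - a) := Real.rpow_nonneg (by linarith [mem_disc.1 hz]) _
    have e : (1 - ‖z‖) ^ (2 - a) / (a - 1 - 1) / (a - 1) -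
        (1 - ρ) ^ (2 - a) / (a - 1 - 1) / (a - 1) =
        ((1 - ρ) ^ (2 - a) - (1 - ‖z‖) ^ (2 - a)) / ((2 - a) * (a - 1)) := by
      rw [show a - 1 - 1 = -(2 - a) by ring]
      field_simp
      ring
    have : ((1 - ρ) ^ (2 - a) - (1 - ‖z‖) ^ (2 - a)) / ((2 - a) * (a - 1)) ≤ η / 6 := by
      rw [div_le_iff₀ (by positivity)]
      linarith [hsm ρ hρ₁ρ hρ]
    rw [e]
    linarith

lemma growthControl_apply_two :
    GrowthControl 2 (fun h => h) (fun t => 3 * -Real.log (1 - t)) := by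
  refine fun η hη => ⟨0, one_pos, fun ρ _ hρ0 hρ => ⟨η / 2, by positivity, fun h M hM hs z hz =>
    ⟨fun hzρ => (hs.mono hM (by linarith)).apply_le hρ0 hρ hzρ, fun hzρ => ?_⟩⟩⟩
  refine (hs.apply_growth two_pos hM (by positivity) hρ0 hρ
    (B := fun t => (1 - t)⁻¹) (E := fun t => -Real.log (1 - t)) (fun t _ ht => ?_)
    (fun t _ _ => le_rfl) (fun t _ ht => hasDerivAt_neg_log ht)
    (inv_nonneg.2 (by linarith)) hz hzρ.le).trans (mul_le_mul_of_nonneg_right ?_ hM)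
  · have h := hasDerivAt_rpow_primitive (α := 2) (by norm_num) ht
    have e : (fun t : ℝ => (1 - t) ^ (1 - 2 : ℝ) / (2 - 1)) = fun t => (1 - t)⁻¹ := by
      funext t
      norm_num [Real.rpow_neg_one]
    rwa [e] at h
  · have := Real.log_nonpos (x := 1 - ρ) (by linarith) (by linarith)
    linarith

lemma growthControl_apply_of_two_lt (h2 : 2 < α) :
    GrowthControl α (fun h => h)
      (fun t => 3 / ((α - 1) * (α - 2)) * (1 - t) ^ (2 - α)) := by
  refine fun η hη => ⟨0, one_pos, fun ρ _ hρ0 hρ => ⟨η / 2, by positivity, fun h M hM hs z hz =>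
    ⟨fun hzρ => (hs.mono hM (by linarith)).apply_le hρ0 hρ hzρ, fun hzρ => ?_⟩⟩⟩
  have hE : ∀ t : ℝ, 0 ≤ t → t < 1 →
      HasDerivAt (fun t : ℝ => (1 - t) ^ (1 - (α - 1)) / ((α - 1) - 1) / (α - 1))
        ((1 - t) ^ (1 - α) / (α - 1)) t := fun t _ ht => by
    have := (hasDerivAt_rpow_primitive (α := α - 1) (by linarith) ht).div_const (α - 1)
    rwa [neg_sub] at this
  refine (hs.apply_growth (by linarith) hM (by positivity) hρ0 hρ
    (fun t _ ht => hasDerivAt_rpow_primitive (by linarith) ht) (fun t _ _ => le_rfl)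
    hE (div_nonneg (Real.rpow_nonneg (by linarith) _) (by linarith)) hz hzρ.le).trans
    (mul_le_mul_of_nonneg_right ?_ hM)
  rw [show 1 - (α - 1) = 2 - α by ring, show α - 1 - 1 = α - 2 by ring]
  have : 0 ≤ (1 - ρ) ^ (2 - α) / (α - 2) / (α - 1) :=
    div_nonneg (div_nonneg (Real.rpow_nonneg (by linarith) _) (by linarith)) (by linarith)
  have e : 3 / ((α - 1) * (α - 2)) * (1 - ‖z‖) ^ (2 - α) =
      3 * ((1 - ‖z‖) ^ (2 - α) / (α - 2) / (α - 1)) := by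
    rw [div_div, mul_comm (α - 2)]
    ring
  linarith

end Growth

/-! ### The upper bound for the essential norm -/

section Upper

variable {α β : ℝ} {g φ : ℂ → ℂ} {T : Zygmund α →L[ℂ] Zygmund β}

/-- The compact perturbation is -TL. Applied to h = f - Lf, both terms of (Th)'' are of size Bη
where |φ| ≤ ρ; where |φ| > ρ the growth functions ω₁, ω₂ meet exactly the weights bounded by A₁, A₂.
-/
lemma IsVolterraComp.essNorm_le (hα : 0 < α) (hT : IsVolterraComp g φ T)
    (hφ : IsAnalyticSelfMap φ) (hg : IsAnalyticOnDisc g) {ω₁ ω₂ : ℝ → ℝ}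
    (hω₁ : GrowthControl α (fun h => deriv h) ω₁) (hω₂ : GrowthControl α (fun h => h) ω₂)
    {A₁ A₂ ρ₀ : ℝ} (hA₁ : 0 ≤ A₁) (hA₂ : 0 ≤ A₂) (hρ₀ : ρ₀ < 1)
    (h₁ : ∀ z ∈ disc, ρ₀ < ‖φ z‖ → weight β z * ‖deriv g z * deriv φ z‖ * ω₁ ‖φ z‖ ≤ A₁)
    (h₂ : ∀ z ∈ disc, ρ₀ < ‖φ z‖ → weight β z * ‖deriv (deriv g) z‖ * ω₂ ‖φ z‖ ≤ A₂) :
    essNorm T ≤ ENNReal.ofReal (A₁ + A₂) := by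
  obtain ⟨B, hB, hBz⟩ := hT.exists_bound hφ hg
  refine ENNReal.le_of_forall_pos_le_add fun δ hδ _ => ?_
  have hg0 := norm_nonneg (deriv g 0)
  -- The errors are η|g'(0)| in (Th)'(0) and Bη in each term of (Th)''; this η makes them add up to
  -- δ.
  set η : ℝ := δ / (‖deriv g 0‖ + 2 * B) with hηdef
  have hden : 0 < ‖deriv g 0‖ + 2 * B := by positivity
  have hη : 0 < η := div_pos (by exact_mod_cast hδ) hden
  have hηδ : η * ‖deriv g 0‖ + 2 * (B * η) = δ := by
    rw [hηdef]
    field_simp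
  obtain ⟨ρ₁, hρ₁, H₁⟩ := hω₁ η hη
  obtain ⟨ρ₂, hρ₂, H₂⟩ := hω₂ η hη
  have hφ0 : ‖φ 0‖ < 1 := mem_disc.1 (hφ.2 zero_mem_disc)
  -- The radius ‖φ 0‖ is included because (Th)'(0) = h(φ(0))g'(0) must also be small.
  set ρ := max (max ρ₀ ‖φ 0‖) (max ρ₁ ρ₂) with hρdef
  have hρ : ρ < 1 := max_lt (max_lt hρ₀ hφ0) (max_lt hρ₁ hρ₂)
  have hρ_0 : ρ₀ ≤ ρ := (le_max_left _ _).trans (le_max_left _ _)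
  have hρφ : ‖φ 0‖ ≤ ρ := (le_max_right _ _).trans (le_max_left _ _)
  have hρnn : 0 ≤ ρ := (norm_nonneg _).trans hρφ
  obtain ⟨ε₁, hε₁, K₁⟩ := H₁ ρ ((le_max_left _ _).trans (le_max_right _ _)) hρnn hρ
  obtain ⟨ε₂, hε₂, K₂⟩ := H₂ ρ ((le_max_right _ _).trans (le_max_right _ _)) hρnn hρ
  obtain ⟨L, hL, hLf⟩ := exists_compact_approx hα hρnn hρ (lt_min hε₁ hε₂)
  have hK : IsCompactOperator (-(T.comp L)) := (hL.clm_comp T).neg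
  have hnorm : ‖T + -(T.comp L)‖ ≤ A₁ + A₂ + δ := by
    refine ContinuousLinearMap.opNorm_le_bound _ (by positivity) fun f => ?_
    obtain ⟨e0, e1, e2, e3⟩ := hLf f
    have e : (T + -(T.comp L)) f = T (f - L f) := by simp [sub_eq_add_neg]
    rw [e]
    set h := f - L f
    have hM := norm_nonneg f
    have hs : IsSmall h ‖f‖ ρ (min ε₁ ε₂) := ⟨e0, e1, e2, e3⟩
    have k₁ := K₁ h ‖f‖ hM (hs.mono hM (min_le_left _ _))
    have k₂ := K₂ h ‖f‖ hM (hs.mono hM (min_le_right _ _))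
    have t0 : T h 0 = 0 := hT.apply_zero h
    have t1 : ‖deriv (T h) 0‖ ≤ η * ‖f‖ * ‖deriv g 0‖ := by
      rw [(hT.hasDerivAt hφ hg h zero_mem_disc).deriv, norm_mul]
      exact mul_le_mul_of_nonneg_right ((k₂ _ (hφ.2 zero_mem_disc)).1 hρφ) hg0
    have t2 : ∀ z ∈ disc, weight β z * ‖deriv (deriv (T h)) z‖ ≤
        (A₁ + A₂ + 2 * (B * η)) * ‖f‖ := by
      intro z hz
      have hw := (weight_pos β hz).le
      rw [hT.deriv_deriv hφ hg h hz]
      have n1 : weight β z * ‖deriv g z * deriv φ z * deriv h (φ z) +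
          deriv (deriv g) z * h (φ z)‖ ≤
          weight β z * ‖deriv g z * deriv φ z‖ * ‖deriv h (φ z)‖ +
          weight β z * ‖deriv (deriv g) z‖ * ‖h (φ z)‖ := by
        have := mul_le_mul_of_nonneg_left (norm_add_le (deriv g z * deriv φ z * deriv h (φ z))
          (deriv (deriv g) z * h (φ z))) hw
        rw [norm_mul _ (deriv h (φ z)), norm_mul _ (h (φ z))] at this
        linarith
      refine n1.trans ?_
      obtain ⟨b1, b2⟩ := hBz z hz
      have p1 : 0 ≤ weight β z * ‖deriv g z * deriv φ z‖ := by positivity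
      have p2 : 0 ≤ weight β z * ‖deriv (deriv g) z‖ := by positivity
      have hηf : 0 ≤ η * ‖f‖ := by positivity
      rcases le_or_gt ‖φ z‖ ρ with hr | hr
      · have q1 := mul_le_mul b1 ((k₁ _ (hφ.2 hz)).1 hr) (norm_nonneg _) hB.le
        have q2 := mul_le_mul b2 ((k₂ _ (hφ.2 hz)).1 hr) (norm_nonneg _) hB.le
        nlinarith [mul_nonneg hA₁ hM, mul_nonneg hA₂ hM]
      · have q1 := mul_le_mul_of_nonneg_left ((k₁ _ (hφ.2 hz)).2 hr) p1
        have q2 := mul_le_mul_of_nonneg_left ((k₂ _ (hφ.2 hz)).2 hr) p2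
        have r1 := mul_le_mul_of_nonneg_right (h₁ z hz (hρ_0.trans_lt hr)) hM
        have r2 := mul_le_mul_of_nonneg_right (h₂ z hz (hρ_0.trans_lt hr)) hM
        have s1 := mul_le_mul_of_nonneg_right b1 hηf
        have s2 := mul_le_mul_of_nonneg_right b2 hηf
        linarith
    have t3 := (T h).norm_le t2
    rw [t0, norm_zero] at t3
    calc ‖T h‖ ≤ η * ‖f‖ * ‖deriv g 0‖ + (A₁ + A₂ + 2 * (B * η)) * ‖f‖ := by linarith
      _ = (A₁ + A₂ + (η * ‖deriv g 0‖ + 2 * (B * η))) * ‖f‖ := by ring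
      _ = (A₁ + A₂ + δ) * ‖f‖ := by rw [hηδ]
  calc essNorm T ≤ ‖T + -(T.comp L)‖ₑ := iInf₂_le (-(T.comp L)) hK
    _ ≤ ENNReal.ofReal (A₁ + A₂ + δ) := by
        rw [← ofReal_norm]
        exact ENNReal.ofReal_le_ofReal hnorm
    _ = ENNReal.ofReal (A₁ + A₂) + δ := by
        rw [ENNReal.ofReal_add (by positivity) (by positivity), ENNReal.ofReal_coe_nnreal]

end Upper

/-! ### Limsups over powers of φ versus weights at the boundary -/

lemma limsup_weightedNorm_le {a : ℕ → ℝ} (ha : ∀ n, 0 ≤ a n) {β C : ℝ} {u φ : ℂ → ℂ}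
    (h : ∀ᶠ n : ℕ in atTop, ∀ z ∈ disc, a n * (weight β z * (‖u z‖ * ‖φ z‖ ^ n)) ≤ C) :
    limsup (fun n : ℕ => ENNReal.ofReal (a n) * weightedNorm β (fun z => u z * φ z ^ n)) atTop ≤
      ENNReal.ofReal C := by
  refine limsup_le_of_le (by isBoundedDefault) ?_
  filter_upwards [h] with n hn
  rw [weightedNorm, ENNReal.mul_iSup]
  refine iSup_le fun z => ?_
  rw [ENNReal.mul_iSup]
  refine iSup_le fun hz => ?_
  rw [← ENNReal.ofReal_mul (ha n), norm_mul, norm_pow]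
  exact ENNReal.ofReal_le_ofReal (hn z hz)

/-- At z the exponent n = ⌈1/(1-|φ(z)|)⌉ is used: |φ(z)|^n ≥ e^(-4), and n ≥ n₀ once |φ(z)| is close
enough to 1. -/
lemma exists_bound_of_limsup_lt {a : ℕ → ℝ} (ha : ∀ n, 0 ≤ a n) {ω : ℝ → ℝ}
    (hω : ∀ t, 1 / 2 ≤ t → t < 1 → ω t ≤ a ⌈1 / (1 - t)⌉₊) {β c : ℝ} {u φ : ℂ → ℂ}
    (hφ : Set.MapsTo φ disc disc)
    (h : limsup (fun n : ℕ => ENNReal.ofReal (a n) * weightedNorm β (fun z => u z * φ z ^ n)) atTop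
      < ENNReal.ofReal c) :
    ∃ ρ₀ < 1, ∀ z ∈ disc, ρ₀ < ‖φ z‖ → weight β z * ‖u z‖ * ω ‖φ z‖ ≤ Real.exp 4 * c := by
  obtain ⟨n₀, hn₀⟩ := eventually_atTop.1 (eventually_lt_of_limsup_lt h)
  have hc : 0 < c := ENNReal.ofReal_pos.1 (pos_of_gt h)
  refine ⟨max (1 / 2) (1 - 1 / (n₀ + 1)), max_lt (by norm_num) ?_, fun z hz hρz => ?_⟩
  · have : (0 : ℝ) < 1 / (n₀ + 1) := by positivity
    linarith
  · have ht1 := mem_disc.1 (hφ hz)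
    have ht2 : 1 / 2 ≤ ‖φ z‖ := ((le_max_left _ _).trans_lt hρz).le
    have ht3 : 1 - ‖φ z‖ < 1 / (n₀ + 1) := by linarith [(le_max_right _ _).trans_lt hρz]
    have hp : 0 < 1 - ‖φ z‖ := by linarith
    have hle : n₀ ≤ ⌈1 / (1 - ‖φ z‖)⌉₊ := by
      have h1 : (n₀ : ℝ) + 1 ≤ 1 / (1 - ‖φ z‖) := by
        rw [le_div_iff₀ hp, mul_comm]
        exact ((lt_div_iff₀ (by positivity)).1 ht3).le
      have h2 := h1.trans (Nat.le_ceil _)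
      have h3 : (n₀ : ℝ) ≤ (⌈1 / (1 - ‖φ z‖)⌉₊ : ℝ) := by linarith
      exact_mod_cast h3
    have hpow := exp_neg_four_le_pow ht2 ht1
    have hωz := hω _ ht2 ht1
    have hn := hn₀ _ hle
    set n := ⌈1 / (1 - ‖φ z‖)⌉₊
    have h1 : ENNReal.ofReal (a n * (weight β z * (‖u z‖ * ‖φ z‖ ^ n))) < ENNReal.ofReal c := by
      refine lt_of_le_of_lt ?_ hn
      rw [ENNReal.ofReal_mul (ha n), weightedNorm]
      gcongr
      refine le_trans (le_of_eq ?_)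
        (le_iSup₂ (f := fun z (_ : z ∈ disc) => ENNReal.ofReal (weight β z * ‖u z * φ z ^ n‖)) z hz)
      rw [norm_mul, norm_pow]
    have h2 := ((ENNReal.ofReal_lt_ofReal_iff hc).1 h1).le
    have hw := (weight_pos β hz).le
    have han := ha n
    have hexp : Real.exp 4 * Real.exp (-4) = 1 := by
      rw [← Real.exp_add]
      simp
    calc weight β z * ‖u z‖ * ω ‖φ z‖ ≤ weight β z * ‖u z‖ * a n := by gcongr
      _ = weight β z * ‖u z‖ * a n * (Real.exp 4 * Real.exp (-4)) := by rw [hexp, mul_one]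
      _ ≤ weight β z * ‖u z‖ * a n * (Real.exp 4 * ‖φ z‖ ^ n) := by gcongr
      _ = Real.exp 4 * (a n * (weight β z * (‖u z‖ * ‖φ z‖ ^ n))) := by ring
      _ ≤ Real.exp 4 * c := by gcongr

lemma exists_bound_of_logLimsup_lt {β c : ℝ} {u φ : ℂ → ℂ} (hφ : Set.MapsTo φ disc disc)
    (h : logLimsup β u φ < ENNReal.ofReal c) :
    ∃ ρ₀ < 1, ∀ z ∈ disc, ρ₀ < ‖φ z‖ →
      weight β z * ‖u z‖ * -Real.log (1 - ‖φ z‖) ≤ Real.exp 4 * c := by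
  refine exists_bound_of_limsup_lt (ω := fun t => -Real.log (1 - t))
    (fun n => Real.log_natCast_nonneg n) (fun t _ ht => ?_) hφ h
  rw [← Real.log_inv]
  refine Real.log_le_log (inv_pos.2 (by linarith)) ?_
  rw [← one_div]
  exact Nat.le_ceil _

lemma exists_bound_of_powLimsup_lt {s β c : ℝ} (hs : 0 ≤ s) {u φ : ℂ → ℂ}
    (hφ : Set.MapsTo φ disc disc) (h : powLimsup s β u φ < ENNReal.ofReal c) :
    ∃ ρ₀ < 1, ∀ z ∈ disc, ρ₀ < ‖φ z‖ →
      weight β z * ‖u z‖ * (1 - ‖φ z‖) ^ (-s) ≤ Real.exp 4 * c := by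
  refine exists_bound_of_limsup_lt (ω := fun t => (1 - t) ^ (-s)) (fun n => by positivity)
    (fun t _ ht => ?_) hφ h
  have hp : 0 < 1 - t := by linarith
  rw [Real.rpow_neg hp.le, ← Real.inv_rpow hp.le, ← one_div]
  exact Real.rpow_le_rpow (by positivity) ((Nat.le_ceil _).trans (by linarith)) hs

/-! ### Comparability in the five regimes -/

/-- If the conclusion failed, a finite c would lie strictly between X and Y/C, against the
hypothesis. Testing with real c also covers X = ∞, where nothing has to be shown. -/
lemma le_ofReal_mul_of_forall_lt {X Y : ℝ≥0∞} {C : ℝ} (hC : 0 < C)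
    (h : ∀ c : ℝ, X < ENNReal.ofReal c → Y ≤ ENNReal.ofReal (C * c)) :
    Y ≤ ENNReal.ofReal C * X := by
  by_contra! hlt
  have hC0 : ENNReal.ofReal C ≠ 0 := by simpa using hC
  have h1 : X < Y / ENNReal.ofReal C := by
    rw [ENNReal.lt_div_iff_mul_lt (Or.inl hC0) (Or.inl ENNReal.ofReal_ne_top), mul_comm]
    exact hlt
  obtain ⟨c, hc1, hc2⟩ := ENNReal.lt_iff_exists_nnreal_btwn.1 h1
  rw [ENNReal.lt_div_iff_mul_lt (Or.inl hC0) (Or.inl ENNReal.ofReal_ne_top)] at hc2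
  have h2 := h c (by rwa [ENNReal.ofReal_coe_nnreal])
  rw [ENNReal.ofReal_mul hC.le, ENNReal.ofReal_coe_nnreal, mul_comm] at h2
  exact absurd h2 (not_le.2 hc2)

lemma comparable_of_le {a b : ℝ≥0∞} {C₁ C₂ : ℝ} (h₁0 : 0 < C₁)
    (h₁ : ∀ c : ℝ, b < ENNReal.ofReal c → a ≤ ENNReal.ofReal (C₁ * c)) (h₂0 : 0 < C₂)
    (h₂ : ∀ c : ℝ, a < ENNReal.ofReal c → b ≤ ENNReal.ofReal (C₂ * c)) :
    Comparable C₁⁻¹.toNNReal C₂.toNNReal a b := by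
  refine ⟨?_, le_ofReal_mul_of_forall_lt h₂0 h₂⟩
  have h := le_ofReal_mul_of_forall_lt h₁0 h₁
  change ENNReal.ofReal C₁⁻¹ * a ≤ b
  rw [ENNReal.ofReal_inv_of_pos h₁0, mul_comm, ← div_eq_mul_inv]
  exact ENNReal.div_le_of_le_mul' h

theorem essNorm_eq_zero_of_lt_one {α β : ℝ} (h0 : 0 < α) (h1 : α < 1) {φ g : ℂ → ℂ}
    (hφ : IsAnalyticSelfMap φ) (hg : IsAnalyticOnDisc g) {T : Zygmund α →L[ℂ] Zygmund β}
    (hT : IsVolterraComp g φ T) : essNorm T = 0 := by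
  have h := hT.essNorm_le h0 hφ hg (growthControl_deriv_of_lt_one h0 h1)
    (growthControl_apply_of_lt_two h0 (by linarith)) le_rfl le_rfl (ρ₀ := 0) one_pos
    (fun z _ _ => by simp) (fun z _ _ => by simp)
  simpa using h

theorem exists_comparable_one (β : ℝ) :
    ∃ C₁ C₂ : ℝ≥0, 0 < C₁ ∧ 0 < C₂ ∧ ∀ φ g : ℂ → ℂ, IsAnalyticSelfMap φ → IsAnalyticOnDisc g →
      ∀ T : Zygmund 1 →L[ℂ] Zygmund β, IsVolterraComp g φ T → Comparable C₁ C₂ (essNorm T)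
        (logLimsup β (fun z => deriv g z * deriv φ z) φ) := by
  obtain ⟨C, hC, hlow⟩ := exists_lower_log_one β
  have hU : 0 < 3 * Real.exp 4 := by positivity
  refine ⟨(3 * Real.exp 4)⁻¹.toNNReal, C.toNNReal, by simpa using hU, by simpa using hC,
    fun φ g hφ hg T hT => comparable_of_le hU (fun c hc => ?_) hC (fun c hc => ?_)⟩
  · have hc0 : 0 < c := ENNReal.ofReal_pos.1 (pos_of_gt hc)
    obtain ⟨ρ₀, hρ₀, hb⟩ := exists_bound_of_logLimsup_lt hφ.2 hc
    -- For α < 2 small functions are themselves uniformly small, so the g''-term contributes A₂ = 0.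
    refine (hT.essNorm_le one_pos hφ hg growthControl_deriv_one
      (growthControl_apply_of_lt_two one_pos one_lt_two) (A₁ := 3 * Real.exp 4 * c) (by positivity)
      le_rfl hρ₀ (fun z hz h => ?_) (fun z _ _ => by simp)).trans_eq (by rw [add_zero])
    have := hb z hz h
    linarith
  · exact limsup_weightedNorm_le (fun n => Real.log_natCast_nonneg n) (hlow φ g hφ hg T hT c hc)

theorem exists_comparable_of_lt_two {α : ℝ} (β : ℝ) (h1 : 1 < α) (h2 : α < 2) :
    ∃ C₁ C₂ : ℝ≥0, 0 < C₁ ∧ 0 < C₂ ∧ ∀ φ g : ℂ → ℂ, IsAnalyticSelfMap φ → IsAnalyticOnDisc g →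
      ∀ T : Zygmund α →L[ℂ] Zygmund β, IsVolterraComp g φ T → Comparable C₁ C₂ (essNorm T)
        (powLimsup (α - 1) β (fun z => deriv g z * deriv φ z) φ) := by
  obtain ⟨C, hC, hlow⟩ := exists_lower_pow_of_lt_two β h1 h2
  have hα1 : 0 < α - 1 := by linarith
  have hU : 0 < 3 / (α - 1) * Real.exp 4 := by positivity
  refine ⟨(3 / (α - 1) * Real.exp 4)⁻¹.toNNReal, C.toNNReal, Real.toNNReal_pos.2 (inv_pos.2 hU),
    by simpa using hC, fun φ g hφ hg T hT => comparable_of_le hU (fun c hc => ?_) hC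
    (fun c hc => ?_)⟩
  · have hc0 : 0 < c := ENNReal.ofReal_pos.1 (pos_of_gt hc)
    obtain ⟨ρ₀, hρ₀, hb⟩ := exists_bound_of_powLimsup_lt hα1.le hφ.2 hc
    refine (hT.essNorm_le (by linarith) hφ hg (growthControl_deriv_of_one_lt h1)
      (growthControl_apply_of_lt_two (by linarith) h2) (A₁ := 3 / (α - 1) * Real.exp 4 * c)
      (by positivity) le_rfl hρ₀ (fun z hz h => ?_) (fun z _ _ => by simp)).trans_eq
      (by rw [add_zero])
    have := mul_le_mul_of_nonneg_left (hb z hz h) (div_pos three_pos hα1).le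
    rw [neg_sub] at this
    linarith
  · exact limsup_weightedNorm_le (fun n => by positivity) (hlow φ g hφ hg T hT c hc)

theorem exists_comparable_two (β : ℝ) :
    ∃ C₁ C₂ : ℝ≥0, 0 < C₁ ∧ 0 < C₂ ∧ ∀ φ g : ℂ → ℂ, IsAnalyticSelfMap φ → IsAnalyticOnDisc g →
      ∀ T : Zygmund 2 →L[ℂ] Zygmund β, IsVolterraComp g φ T → Comparable C₁ C₂ (essNorm T)
        (max (powLimsup 1 β (fun z => deriv g z * deriv φ z) φ)
          (logLimsup β (deriv (deriv g)) φ)) := by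
  obtain ⟨C, hC, hlow⟩ := exists_lower_pow_of_two_le β (α := 2) le_rfl
  obtain ⟨C', hC', hlow'⟩ := exists_lower_log_two β
  have hU : 0 < 6 * Real.exp 4 := by positivity
  have hL : 0 < max C C' := lt_max_of_lt_left hC
  refine ⟨(6 * Real.exp 4)⁻¹.toNNReal, (max C C').toNNReal, Real.toNNReal_pos.2 (inv_pos.2 hU),
    Real.toNNReal_pos.2 hL, fun φ g hφ hg T hT => comparable_of_le hU (fun c hc => ?_) hL
    (fun c hc => ?_)⟩
  · have hc0 : 0 < c := ENNReal.ofReal_pos.1 (pos_of_gt hc)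
    obtain ⟨hc1, hc2⟩ := max_lt_iff.1 hc
    obtain ⟨ρ₁, hρ₁, hb₁⟩ := exists_bound_of_powLimsup_lt zero_le_one hφ.2 hc1
    obtain ⟨ρ₂, hρ₂, hb₂⟩ := exists_bound_of_logLimsup_lt hφ.2 hc2
    refine (hT.essNorm_le two_pos hφ hg (growthControl_deriv_of_one_lt one_lt_two)
      growthControl_apply_two (A₁ := 3 * Real.exp 4 * c) (A₂ := 3 * Real.exp 4 * c)
      (by positivity) (by positivity) (max_lt hρ₁ hρ₂) (fun z hz h => ?_)
      (fun z hz h => ?_)).trans_eq (by ring_nf)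
    · have := hb₁ z hz ((le_max_left _ _).trans_lt h)
      norm_num at this ⊢
      linarith
    · have := hb₂ z hz ((le_max_right _ _).trans_lt h)
      linarith
  · have hc0 : 0 < c := ENNReal.ofReal_pos.1 (pos_of_gt hc)
    refine max_le (limsup_weightedNorm_le (fun n => by positivity) ?_)
      (limsup_weightedNorm_le (fun n => Real.log_natCast_nonneg n) ?_)
    · filter_upwards [hlow φ g hφ hg T hT c hc] with n hn z hz
      have := (hn z hz).1
      rw [show (2 : ℝ) - 1 = 1 by norm_num] at this
      exact this.trans (mul_le_mul_of_nonneg_right (le_max_left _ _) hc0.le)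
    · filter_upwards [hlow' φ g hφ hg T hT c hc] with n hn z hz
      exact (hn z hz).trans (mul_le_mul_of_nonneg_right (le_max_right _ _) hc0.le)

theorem exists_comparable_of_two_lt {α : ℝ} (β : ℝ) (h2 : 2 < α) :
    ∃ C₁ C₂ : ℝ≥0, 0 < C₁ ∧ 0 < C₂ ∧ ∀ φ g : ℂ → ℂ, IsAnalyticSelfMap φ → IsAnalyticOnDisc g →
      ∀ T : Zygmund α →L[ℂ] Zygmund β, IsVolterraComp g φ T → Comparable C₁ C₂ (essNorm T)
        (max (powLimsup (α - 1) β (fun z => deriv g z * deriv φ z) φ)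
          (powLimsup (α - 2) β (deriv (deriv g)) φ)) := by
  obtain ⟨C, hC, hlow⟩ := exists_lower_pow_of_two_le β h2.le
  have hα1 : 0 < α - 1 := by linarith
  have hα2 : 0 < α - 2 := by linarith
  set U : ℝ := 3 / (α - 1) * Real.exp 4 + 3 / ((α - 1) * (α - 2)) * Real.exp 4 with hUdef
  have hU : 0 < U := by positivity
  refine ⟨U⁻¹.toNNReal, C.toNNReal, Real.toNNReal_pos.2 (inv_pos.2 hU),
    Real.toNNReal_pos.2 hC, fun φ g hφ hg T hT => comparable_of_le hU (fun c hc => ?_) hC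
    (fun c hc => ?_)⟩
  · have hc0 : 0 < c := ENNReal.ofReal_pos.1 (pos_of_gt hc)
    obtain ⟨hc1, hc2⟩ := max_lt_iff.1 hc
    obtain ⟨ρ₁, hρ₁, hb₁⟩ := exists_bound_of_powLimsup_lt hα1.le hφ.2 hc1
    obtain ⟨ρ₂, hρ₂, hb₂⟩ := exists_bound_of_powLimsup_lt hα2.le hφ.2 hc2
    refine (hT.essNorm_le (by linarith) hφ hg (growthControl_deriv_of_one_lt (by linarith))
      (growthControl_apply_of_two_lt h2) (A₁ := 3 / (α - 1) * Real.exp 4 * c)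
      (A₂ := 3 / ((α - 1) * (α - 2)) * Real.exp 4 * c)
      (by positivity) (by positivity) (max_lt hρ₁ hρ₂) (fun z hz h => ?_)
      (fun z hz h => ?_)).trans_eq (by rw [hUdef, add_mul])
    · have := mul_le_mul_of_nonneg_left (hb₁ z hz ((le_max_left _ _).trans_lt h))
        (div_pos three_pos hα1).le
      rw [neg_sub] at this
      linarith
    · have := mul_le_mul_of_nonneg_left (hb₂ z hz ((le_max_right _ _).trans_lt h))
        (div_pos three_pos (mul_pos hα1 hα2)).le
      rw [neg_sub] at this
      linarith
  · refine max_le (limsup_weightedNorm_le (fun n => by positivity) ?_)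
      (limsup_weightedNorm_le (fun n => by positivity) ?_)
    · filter_upwards [hlow φ g hφ hg T hT c hc] with n hn z hz using (hn z hz).1
    · filter_upwards [hlow φ g hφ hg T hT c hc] with n hn z hz using (hn z hz).2

end VolterraZygmund

end

open VolterraZygmund
open scoped NNReal ENNReal
theorem theorem3p4 (α β : ℝ) (hα : 0 < α) (hβ : 0 < β) :
    ∃ C₁ C₂ : ℝ≥0, 0 < C₁ ∧ 0 < C₂ ∧
      ∀ (φ g : ℂ → ℂ), IsAnalyticSelfMap φ → IsAnalyticOnDisc g →
      ∀ T : Zygmund α →L[ℂ] Zygmund β, IsVolterraComp g φ T →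
        (α < 1 → essNorm T = 0) ∧
        (α = 1 → Comparable C₁ C₂ (essNorm T)
          (logLimsup β (fun z => deriv g z * deriv φ z) φ)) ∧
        (1 < α → α < 2 → Comparable C₁ C₂ (essNorm T)
          (powLimsup (α - 1) β (fun z => deriv g z * deriv φ z) φ)) ∧
        (α = 2 → Comparable C₁ C₂ (essNorm T)
          (max (powLimsup 1 β (fun z => deriv g z * deriv φ z) φ)
            (logLimsup β (deriv (deriv g)) φ))) ∧
        (2 < α → Comparable C₁ C₂ (essNorm T)
          (max (powLimsup (α - 1) β (fun z => deriv g z * deriv φ z) φ)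
            (powLimsup (α - 2) β (deriv (deriv g)) φ))) := by
  rcases lt_trichotomy α 1 with h1 | rfl | h1
  -- No comparison is made for α < 1, so the constants are arbitrary here.
  · exact ⟨1, 1, one_pos, one_pos, fun φ g hφ hg T hT =>
      ⟨fun _ => essNorm_eq_zero_of_lt_one hα h1 hφ hg hT, fun h => by linarith,
        fun h _ => by linarith, fun h => by linarith, fun h => by linarith⟩⟩
  · obtain ⟨C₁, C₂, hC₁, hC₂, h⟩ := exists_comparable_one β
    exact ⟨C₁, C₂, hC₁, hC₂, fun φ g hφ hg T hT =>
      ⟨fun h => by linarith, fun _ => h φ g hφ hg T hT,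
        fun h _ => by linarith, fun h => by linarith, fun h => by linarith⟩⟩
  rcases lt_trichotomy α 2 with h2 | rfl | h2
  · obtain ⟨C₁, C₂, hC₁, hC₂, h⟩ := exists_comparable_of_lt_two β h1 h2
    exact ⟨C₁, C₂, hC₁, hC₂, fun φ g hφ hg T hT =>
      ⟨fun h => by linarith, fun h => by linarith,
        fun _ _ => h φ g hφ hg T hT, fun h => by linarith, fun h => by linarith⟩⟩
  · obtain ⟨C₁, C₂, hC₁, hC₂, h⟩ := exists_comparable_two β
    exact ⟨C₁, C₂, hC₁, hC₂, fun φ g hφ hg T hT =>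
      ⟨fun h => by linarith, fun h => by linarith,
        fun _ h => by linarith, fun _ => h φ g hφ hg T hT, fun h => by linarith⟩⟩
  · obtain ⟨C₁, C₂, hC₁, hC₂, h⟩ := exists_comparable_of_two_lt β h2
    exact ⟨C₁, C₂, hC₁, hC₂, fun φ g hφ hg T hT =>
      ⟨fun h => by linarith, fun h => by linarith,
        fun _ h => by linarith, fun h => by linarith, fun _ => h φ g hφ hg T hT⟩⟩
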